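/- Let $T$ be a nondegenerate geodesic triangle with side lengths $a,b,c$ in the Euclidean plane, in the hyperbolic plane (of curvature $-1$), or on the unit sphere $S^2$ (vertices not on a common great circle, sides the minor great-circle arcs, lengths and radii measured along the sphere). Put $s(x)=\frac{x}{2}$ in Euclidean geometry, $s(x)=\sinh\frac{x}{2}$ in hyperbolic geometry and $s(x)=\sin\frac{x}{2}$ in spherical geometry, and $$M=\frac{2\,s\left(\frac{a+b}{2}\right)s\left(\frac{a+c}{2}\right)s\left(\frac{b+c}{2}\right)}{s(a)\,s(b)\,s(c)}.$$ Let $r$ be the radius of the inscribed circle of $T$ and $R$ the radius of its circumscribed circle (in spherical geometry the radius less than $\frac{\pi}{2}$; in hyperbolic geometry the statements about $R$ are made for those triangles that have a circumscribed circle). Then $$\frac{R}{r}\ \ge\ M\ \ge\ 2\ \text{ (Euclidean)},\qquad \frac{\tanh R}{\tanh r}\ \ge\ M\ \ge\ 2\ \text{ (hyperbolic)},\qquad \frac{\tan R}{\tan r}\ \ge\ M\ \ge\ 2\ \text{ (spherical)}.$$ In each geometry, equality holds in the left inequality if and only if $a=b=c$, and equality holds in the right inequality if and only if $a=b=c$.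 In hyperbolic geometry the right inequality $M\ge 2$ and its equality case hold for all triangles, whether or not a circumscribed circle exists. -/

import Mathlib

noncomputable section

/-- The function `s` of Euclidean geometry. -/
def sEuc (x : ℝ) : ℝ := x / 2

/-- The function `s` of hyperbolic geometry. -/
def sHyp (x : ℝ) : ℝ := Real.sinh (x / 2)

/-- The function `s` of spherical geometry. -/
def sSph (x : ℝ) : ℝ := Real.sin (x / 2)

/-- The middle term of the chain of inequalities, for a given function `s`. -/
def middleTerm (s : ℝ → ℝ) (a b c : ℝ) : ℝ :=
  2 * s ((a + b) / 2) * s ((a + c) / 2) * s ((b + c) / 2) / (s a * s b * s c)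

/-- The unit sphere in Euclidean 3-space. -/
abbrev UnitSphere : Type := Metric.sphere (0 : EuclideanSpace ℝ (Fin 3)) 1

/-- The intrinsic (great-circle) distance on the unit sphere. -/
def sphDist (x y : UnitSphere) : ℝ :=
  InnerProductGeometry.angle (x : EuclideanSpace ℝ (Fin 3)) (y : EuclideanSpace ℝ (Fin 3))

section Circles

/-! Below, `d` is the geodesic distance of the geometry: `dist` on the hyperbolic plane,
`sphDist` on the sphere. -/

variable {X : Type} (d : X → X → ℝ)

/-- The geodesic segment with endpoints `P`, `Q`: all points lying between them. -/
def geodSegment (P Q : X) : Set X := {Z | d P Z + d Z Q = d P Q}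

/-- The (closed, filled) triangle with vertices `A`, `B`, `C`: the union of the geodesic
segments from `A` to the points of the side `BC`. -/
def filledTriangle (A B C : X) : Set X := {Z | ∃ D ∈ geodSegment d B C, Z ∈ geodSegment d A D}

/-- `A`, `B`, `C` lie on the circle with centre `O` and radius `R`. -/
def IsCircumscribedCircle (A B C O : X) (R : ℝ) : Prop :=
  d O A = R ∧ d O B = R ∧ d O C = R

/-- The circle with centre `I` and radius `r` is inscribed in the triangle `ABC`: its centre is
in the triangle, and `r` is the (attained) distance from the centre to each of the three sides. -/
def IsInscribedCircle (A B C I : X) (r : ℝ) : Prop :=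
  I ∈ filledTriangle d A B C ∧
    IsLeast (d I '' geodSegment d B C) r ∧
    IsLeast (d I '' geodSegment d C A) r ∧
    IsLeast (d I '' geodSegment d A B) r

end Circles

/-- `A`, `B`, `C` are the vertices of a (nondegenerate) hyperbolic triangle: they do not lie on a
common geodesic, i.e. none of them lies between the other two. -/
def IsHypTriangle (A B C : UpperHalfPlane) : Prop :=
  A ∉ geodSegment dist B C ∧ B ∉ geodSegment dist C A ∧ C ∉ geodSegment dist A B

/-- `A`, `B`, `C` are the vertices of a (nondegenerate) spherical triangle, with sides the minor
great-circle arcs: they do not lie on a common great circle. -/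
def IsSphTriangle (A B C : UnitSphere) : Prop :=
  LinearIndependent ℝ ![(A : EuclideanSpace ℝ (Fin 3)), (B : EuclideanSpace ℝ (Fin 3)),
    (C : EuclideanSpace ℝ (Fin 3))]

end

/-! Everything rests on one formula for the ratio of the radii. With tangent ratios in the curved
cases and plain radii in the Euclidean one, the quotient equals `2 * (s a * s b * s c) / (s (b + c -
a) * s (a + c - b) * s (a + b - c))`. After that only products of values of `s` have to be compared,
and the only fact about `s` that matters is that `s x * s y = g (x + y) - g |x - y|` with `g`
increasing: for a fixed sum, the product grows as the arguments approach each other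
(`SpreadDecreasing`). The inequality `M ≥ 2` multiplies three midpoint comparisons
(`two_le_middleTerm`). The bound on `M` from above is `∏ s ((a + b) / 2) * ∏ s (b + c - a) ≤ (∏ s a)
^ 2`, a product of four comparisons of pairs in which two auxiliary factors cancel
(`prod_diff_le_of_sorted`). Equality is traced to a strict comparison.

The curved ratio formula is proved once, for points realized as unit vectors of a quadratic space of
dimension three: the sphere, or a sheet of a hyperboloid, with a sign `σ` telling them apart
(`IsQuadricModel`). Let `G` be the Gram determinant of the vertices, and `u`, `v`, `w` the
semiperimeter minus each side, so that the semiperimeter is `u + v + w`. Then `G = 4 * sn (u + v +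
w) * (sn u * sn v * sn w)`. The incentre is proportional to the sum of the vertices weighted by `sn`
of the opposite sides, and its normalization gives the inradius (`sn_inradius_sq`). The circumcentre
has equal products with the three vertices, and inverting the Gram matrix gives the circumradius
(`sn_circumradius_sq`). The quotient is `tan_ratio`. The Euclidean formula comes from Heron's
formula, the heights and the law of sines (`circumradius_div_inradius`). -/

noncomputable section

/-! ### Product inequalities for a function whose products decrease with spread -/

/-- Replacing two arguments below `m` by two closer ones with the same sum increases the product
of the values of `s`, and `s` is positive on positive arguments below `m`. -/
structure SpreadDecreasing (s : ℝ → ℝ) (m : ℝ) : Prop where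
  pos : ∀ x, 0 < x → x < m → 0 < s x
  mul_lt : ∀ x y x' y', 0 < x → 0 < y → x < m → y < m → x + y = x' + y' →
    |x' - y'| < |x - y| → s x * s y < s x' * s y'

namespace SpreadDecreasing

variable {s : ℝ → ℝ} {m : ℝ}

theorem mul_le (h : SpreadDecreasing s m) {x y x' y' : ℝ} (hx : 0 < x) (hy : 0 < y) (hxm : x < m)
    (hym : y < m) (hs : x + y = x' + y') (ha : |x' - y'| ≤ |x - y|) :
    s x * s y ≤ s x' * s y' := by
  rcases ha.lt_or_eq with ha | ha
  · exact (h.mul_lt x y x' y' hx hy hxm hym hs ha).le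
  · rcases abs_eq_abs.1 ha with h1 | h1
    · have e1 : x' = x := by linarith
      have e2 : y' = y := by linarith
      rw [e1, e2]
    · have e1 : x' = y := by linarith
      have e2 : y' = x := by linarith
      rw [e1, e2, mul_comm]

theorem mul_le_sq_mid (h : SpreadDecreasing s m) {x y : ℝ} (hx : 0 < x) (hy : 0 < y) (hxm : x < m)
    (hym : y < m) : s x * s y ≤ s ((x + y) / 2) ^ 2 := by
  rw [sq]
  exact h.mul_le hx hy hxm hym (by ring) (by simp)

theorem mul_lt_sq_mid (h : SpreadDecreasing s m) {x y : ℝ} (hx : 0 < x) (hy : 0 < y) (hxm : x < m)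
    (hym : y < m) (hxy : x ≠ y) : s x * s y < s ((x + y) / 2) ^ 2 := by
  rw [sq]
  exact h.mul_lt _ _ _ _ hx hy hxm hym (by ring) (by simpa using sub_ne_zero.2 hxy)

/-- The product of the three midpoint comparisons is the square of the claim, since each side occurs
in two pairs. -/
theorem prod_le_prod_mid (h : SpreadDecreasing s m) {a b c : ℝ} (ha : 0 < a) (hb : 0 < b)
    (hc : 0 < c) (ham : a < m) (hbm : b < m) (hcm : c < m) :
    s a * s b * s c ≤ s ((a + b) / 2) * s ((a + c) / 2) * s ((b + c) / 2) ∧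
    (s a * s b * s c = s ((a + b) / 2) * s ((a + c) / 2) * s ((b + c) / 2) → a = b ∧ b = c) := by
  have pa := h.pos a ha ham
  have pb := h.pos b hb hbm
  have pc := h.pos c hc hcm
  have pab := h.pos ((a + b) / 2) (by linarith) (by linarith)
  have pac := h.pos ((a + c) / 2) (by linarith) (by linarith)
  have pbc := h.pos ((b + c) / 2) (by linarith) (by linarith)
  have h1 := h.mul_le_sq_mid ha hb ham hbm
  have h2 := h.mul_le_sq_mid ha hc ham hcm
  have h3 := h.mul_le_sq_mid hb hc hbm hcm
  have h12 : (s a * s b) * (s a * s c) ≤ s ((a + b) / 2) ^ 2 * s ((a + c) / 2) ^ 2 :=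
    mul_le_mul h1 h2 (by positivity) (by positivity)
  have key : (s a * s b * s c) ^ 2 ≤
      (s ((a + b) / 2) * s ((a + c) / 2) * s ((b + c) / 2)) ^ 2 := by
    calc _ = ((s a * s b) * (s a * s c)) * (s b * s c) := by ring
      _ ≤ (s ((a + b) / 2) ^ 2 * s ((a + c) / 2) ^ 2) * s ((b + c) / 2) ^ 2 :=
        mul_le_mul h12 h3 (by positivity) (by positivity)
      _ = _ := by ring
  refine ⟨le_of_sq_le_sq key (by positivity), fun e => ?_⟩
  by_contra hne
  have hlt : (s a * s b * s c) ^ 2 <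
      (s ((a + b) / 2) * s ((a + c) / 2) * s ((b + c) / 2)) ^ 2 := by
    by_cases hab : a = b
    · have hbc : b ≠ c := fun e => hne ⟨hab, e⟩
      calc _ = ((s a * s b) * (s a * s c)) * (s b * s c) := by ring
        _ < (s ((a + b) / 2) ^ 2 * s ((a + c) / 2) ^ 2) * s ((b + c) / 2) ^ 2 :=
          mul_lt_mul' h12 (h.mul_lt_sq_mid hb hc hbm hcm hbc) (by positivity) (by positivity)
        _ = _ := by ring
    · calc _ = (s a * s b) * ((s a * s c) * (s b * s c)) := by ring
        _ < s ((a + b) / 2) ^ 2 * (s ((a + c) / 2) ^ 2 * s ((b + c) / 2) ^ 2) :=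
          mul_lt_mul (h.mul_lt_sq_mid ha hb ham hbm hab)
            (mul_le_mul h2 h3 (by positivity) (by positivity)) (by positivity) (by positivity)
        _ = _ := by ring
  rw [e] at hlt
  exact lt_irrefl _ hlt

theorem two_le_middleTerm (h : SpreadDecreasing s m) {a b c : ℝ} (ha : 0 < a) (hb : 0 < b)
    (hc : 0 < c) (ham : a < m) (hbm : b < m) (hcm : c < m) :
    middleTerm s a b c ≥ 2 ∧ (middleTerm s a b c = 2 ↔ a = b ∧ b = c) := by
  obtain ⟨h1, h2⟩ := h.prod_le_prod_mid ha hb hc ham hbm hcm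
  have pa := h.pos a ha ham
  have pb := h.pos b hb hbm
  have pc := h.pos c hc hcm
  have hp : 0 < s a * s b * s c := by positivity
  refine ⟨?_, fun e => h2 ?_, ?_⟩
  · rw [middleTerm, ge_iff_le, le_div_iff₀ hp]
    linarith
  · rw [middleTerm, div_eq_iff hp.ne'] at e
    linarith
  · rintro ⟨rfl, rfl⟩
    rw [middleTerm, div_eq_iff hp.ne', add_self_div_two]
    ring

/-- The product inequality behind `M ≤ tan R / tan r`, for sorted sides. -/
theorem prod_diff_le_of_sorted (h : SpreadDecreasing s m) {a b c : ℝ} (hc : 0 < c) (hbc : c ≤ b)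
    (hab : b ≤ a) (habc : a < b + c) (ham : 2 * a < m) :
    s ((a + b) / 2) * s ((a + c) / 2) * s ((b + c) / 2) *
        (s (b + c - a) * s (a + c - b) * s (a + b - c)) ≤ (s a * s b * s c) ^ 2 ∧
    (s ((a + b) / 2) * s ((a + c) / 2) * s ((b + c) / 2) *
        (s (b + c - a) * s (a + c - b) * s (a + b - c)) = (s a * s b * s c) ^ 2 →
      a = b ∧ b = c) := by
  have pa := h.pos a (by linarith) (by linarith)
  have pb := h.pos b (by linarith) (by linarith)
  have pc := h.pos c (by linarith) (by linarith)
  have pab := h.pos ((a + b) / 2) (by linarith) (by linarith)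
  have pac := h.pos ((a + c) / 2) (by linarith) (by linarith)
  have pbc := h.pos ((b + c) / 2) (by linarith) (by linarith)
  have p1 := h.pos (b + c - a) (by linarith) (by linarith)
  have p2 := h.pos (a + c - b) (by linarith) (by linarith)
  have p3 := h.pos (a + b - c) (by linarith) (by linarith)
  -- The split is on whether `b - c ≤ a - b`, which is exactly what `e4` needs; the second case is
  -- the first with the formal roles of `a` and `c` exchanged.
  by_cases hcase : 2 * b - c ≤ a
  -- The arguments `c - (a - b) / 2` and `c + (a - b) / 2` are chosen to complete pairs with equal
  -- sums. Each occurs once on either side of the product of `e1` to `e4`, so both cancel.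
  · have pu := h.pos (c - (a - b) / 2) (by linarith) (by linarith)
    have pv := h.pos (c + (a - b) / 2) (by linarith) (by linarith)
    have e1 : s (a + b - c) * s (a + c - b) ≤ s a * s a :=
      h.mul_le (by linarith) (by linarith) (by linarith) (by linarith) (by ring) (by simp)
    have e2 : s ((a + b) / 2) * s (c - (a - b) / 2) ≤ s b * s c :=
      h.mul_le (by linarith) (by linarith) (by linarith) (by linarith) (by ring)
        (by rw [abs_of_nonneg (by linarith), abs_of_nonneg (by linarith)]; linarith)
    have e3 : s (b + c - a) * s (c + (a - b) / 2) ≤ s c * s (c - (a - b) / 2) :=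
      h.mul_le (by linarith) (by linarith) (by linarith) (by linarith) (by ring)
        (by rw [abs_of_nonneg (by linarith), abs_of_nonpos (by linarith)]; linarith)
    have e4 : s ((a + c) / 2) * s ((b + c) / 2) ≤ s b * s (c + (a - b) / 2) :=
      h.mul_le (by linarith) (by linarith) (by linarith) (by linarith) (by ring)
        (by rw [abs_le, abs_of_nonneg (a := (a + c) / 2 - (b + c) / 2) (by linarith)]
            constructor <;> linarith)
    have e34 := mul_le_mul e3 e4 (by positivity) (by positivity)
    have e234 := mul_le_mul e2 e34 (by positivity) (by positivity)
    have e1234 := mul_le_mul e1 e234 (by positivity) (by positivity)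
    have hp : 0 < s (c - (a - b) / 2) * s (c + (a - b) / 2) := by positivity
    refine ⟨le_of_mul_le_mul_right (by linarith) hp, fun e => ?_⟩
    by_contra hne
    -- `e1` is strict when `b ≠ c`, and `e2` is strict when `a ≠ b`, so together they detect every
    -- non-equilateral triangle.
    have hlt : s (a + b - c) * s (a + c - b) < s a * s a ∨
        s ((a + b) / 2) * s (c - (a - b) / 2) < s b * s c := by
      by_cases hb : b = c
      · right
        refine h.mul_lt _ _ _ _ (by linarith) (by linarith) (by linarith) (by linarith) (by ring) ?_
        have : b < a := lt_of_le_of_ne hab fun e => hne ⟨e.symm, hb⟩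
        rw [abs_of_nonneg (by linarith), abs_of_nonneg (by linarith)]; linarith
      · left
        refine h.mul_lt _ _ _ _ (by linarith) (by linarith) (by linarith) (by linarith) (by ring) ?_
        have : c < b := lt_of_le_of_ne hbc fun e => hb e.symm
        rw [abs_of_nonneg (by linarith), abs_of_nonneg (by linarith)]; linarith
    have hlt' : (s (a + b - c) * s (a + c - b)) * (s ((a + b) / 2) * s (c - (a - b) / 2)) <
        (s a * s a) * (s b * s c) := by
      rcases hlt with hlt | hlt
      · exact mul_lt_mul hlt e2 (by positivity) (by positivity)
      · exact mul_lt_mul' e1 hlt (by positivity) (by positivity)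
    have := mul_lt_mul hlt' e34 (by positivity) (by positivity)
    have e' := congrArg (· * (s (c - (a - b) / 2) * s (c + (a - b) / 2))) e
    linarith
  · have pu := h.pos (a + (b - c) / 2) (by linarith) (by linarith)
    have pv := h.pos (a - (b - c) / 2) (by linarith) (by linarith)
    have e1 : s (b + c - a) * s (a + c - b) ≤ s c * s c :=
      h.mul_le (by linarith) (by linarith) (by linarith) (by linarith) (by ring) (by simp)
    have e2 : s ((b + c) / 2) * s (a + (b - c) / 2) ≤ s b * s a :=
      h.mul_le (by linarith) (by linarith) (by linarith) (by linarith) (by ring)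
        (by rw [abs_of_nonpos (by linarith), abs_of_nonpos (by linarith)]; linarith)
    have e3 : s (a + b - c) * s (a - (b - c) / 2) ≤ s a * s (a + (b - c) / 2) :=
      h.mul_le (by linarith) (by linarith) (by linarith) (by linarith) (by ring)
        (by rw [abs_of_nonpos (by linarith), abs_of_nonneg (by linarith)]; linarith)
    have e4 : s ((a + c) / 2) * s ((a + b) / 2) ≤ s b * s (a - (b - c) / 2) :=
      h.mul_le (by linarith) (by linarith) (by linarith) (by linarith) (by ring)
        (by rw [abs_le, abs_of_nonpos (a := (a + c) / 2 - (a + b) / 2) (by linarith)]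
            constructor <;> linarith)
    have e34 := mul_le_mul e3 e4 (by positivity) (by positivity)
    have e234 := mul_le_mul e2 e34 (by positivity) (by positivity)
    have e1234 := mul_le_mul e1 e234 (by positivity) (by positivity)
    have hp : 0 < s (a + (b - c) / 2) * s (a - (b - c) / 2) := by positivity
    refine ⟨le_of_mul_le_mul_right (by linarith) hp, fun e => ?_⟩
    by_contra hne
    have hlt : s (b + c - a) * s (a + c - b) < s c * s c ∨
        s ((b + c) / 2) * s (a + (b - c) / 2) < s b * s a := by
      by_cases hb : a = b
      · right
        refine h.mul_lt _ _ _ _ (by linarith) (by linarith) (by linarith) (by linarith) (by ring) ?_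
        have : c < b := lt_of_le_of_ne hbc fun e => hne ⟨hb, e.symm⟩
        rw [abs_of_nonpos (by linarith), abs_of_nonpos (by linarith)]; linarith
      · left
        refine h.mul_lt _ _ _ _ (by linarith) (by linarith) (by linarith) (by linarith) (by ring) ?_
        have : b < a := lt_of_le_of_ne hab fun e => hb e.symm
        rw [abs_of_nonneg (by linarith), abs_of_nonpos (by linarith)]; linarith
    have hlt' : (s (b + c - a) * s (a + c - b)) * (s ((b + c) / 2) * s (a + (b - c) / 2)) <
        (s c * s c) * (s b * s a) := by
      rcases hlt with hlt | hlt
      · exact mul_lt_mul hlt e2 (by positivity) (by positivity)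
      · exact mul_lt_mul' e1 hlt (by positivity) (by positivity)
    have := mul_lt_mul hlt' e34 (by positivity) (by positivity)
    have e' := congrArg (· * (s (a + (b - c) / 2) * s (a - (b - c) / 2))) e
    linarith

theorem prod_diff_le (h : SpreadDecreasing s m) {a b c : ℝ} (h1 : a < b + c) (h2 : b < a + c)
    (h3 : c < a + b) (ham : 2 * a < m) (hbm : 2 * b < m) (hcm : 2 * c < m) :
    s ((a + b) / 2) * s ((a + c) / 2) * s ((b + c) / 2) *
        (s (b + c - a) * s (a + c - b) * s (a + b - c)) ≤ (s a * s b * s c) ^ 2 ∧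
    (s ((a + b) / 2) * s ((a + c) / 2) * s ((b + c) / 2) *
        (s (b + c - a) * s (a + c - b) * s (a + b - c)) = (s a * s b * s c) ^ 2 →
      a = b ∧ b = c) := by
  wlog hab : b ≤ a generalizing a b
  · obtain ⟨h4, h5⟩ := this h2 h1 (by linarith) hbm ham (by linarith)
    rw [add_comm b a] at h4 h5
    refine ⟨by linarith, fun e => ?_⟩
    obtain ⟨rfl, rfl⟩ := h5 (by linarith)
    exact ⟨rfl, rfl⟩
  wlog hbc : c ≤ b generalizing a b c
  · wlog hac : c ≤ a generalizing a b c
    · obtain ⟨h4, h5⟩ := h.prod_diff_le_of_sorted (a := c) (b := a) (c := b) (by linarith) hab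
        (by linarith) h3 hcm
      rw [add_comm c a, add_comm c b] at h4 h5
      refine ⟨by linarith, fun e => ?_⟩
      obtain ⟨rfl, rfl⟩ := h5 (by linarith)
      exact ⟨rfl, rfl⟩
    · obtain ⟨h4, h5⟩ := h.prod_diff_le_of_sorted (a := a) (b := c) (c := b) (by linarith)
        (by linarith) hac (by linarith) ham
      rw [add_comm c b] at h4 h5
      refine ⟨by linarith, fun e => ?_⟩
      obtain ⟨rfl, rfl⟩ := h5 (by linarith)
      exact ⟨rfl, rfl⟩
  exact h.prod_diff_le_of_sorted (by linarith) hbc hab h1 ham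

/-- The inequality between `2 ∏ s(a) / ∏ s(b + c - a)` and the middle term. -/
theorem middleTerm_le (h : SpreadDecreasing s m) {a b c : ℝ} (h1 : a < b + c) (h2 : b < a + c)
    (h3 : c < a + b) (ham : 2 * a < m) (hbm : 2 * b < m) (hcm : 2 * c < m) :
    2 * (s a * s b * s c) / (s (b + c - a) * s (a + c - b) * s (a + b - c)) ≥
        middleTerm s a b c ∧
    (2 * (s a * s b * s c) / (s (b + c - a) * s (a + c - b) * s (a + b - c)) =
        middleTerm s a b c ↔ a = b ∧ b = c) := by
  obtain ⟨h4, h5⟩ := h.prod_diff_le h1 h2 h3 ham hbm hcm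
  have pa := h.pos a (by linarith) (by linarith)
  have pb := h.pos b (by linarith) (by linarith)
  have pc := h.pos c (by linarith) (by linarith)
  have p1 := h.pos (b + c - a) (by linarith) (by linarith)
  have p2 := h.pos (a + c - b) (by linarith) (by linarith)
  have p3 := h.pos (a + b - c) (by linarith) (by linarith)
  have hp : 0 < s a * s b * s c := by positivity
  have hq : 0 < s (b + c - a) * s (a + c - b) * s (a + b - c) := by positivity
  refine ⟨?_, fun e => h5 ?_, ?_⟩
  · rw [middleTerm, ge_iff_le, div_le_div_iff₀ hp hq]
    linarith
  · rw [middleTerm, div_eq_div_iff hq.ne' hp.ne'] at e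
    linarith
  · rintro ⟨rfl, rfl⟩
    rw [middleTerm, div_eq_div_iff hq.ne' hp.ne', add_self_div_two, add_sub_cancel_right]
    ring

end SpreadDecreasing

/-! ### The product-to-sum formula in the three geometries -/

/-- The term `g (x + y)` depends only on the sum and drops out of the comparison, so `g` need be
increasing only on `[0, m)`, where the differences lie. -/
theorem spreadDecreasing_of_sub (s : ℝ → ℝ) (g : ℝ → ℝ) (m : ℝ)
    (hs : ∀ x, 0 < x → x < m → 0 < s x)
    (hmul : ∀ x y, s x * s y = g (x + y) - g |x - y|)
    (hg : ∀ x y, 0 ≤ x → x < y → y < m → g x < g y) : SpreadDecreasing s m where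
  pos := hs
  mul_lt x y x' y' hx hy hxm hym hsum hlt := by
    rw [hmul, hmul, hsum]
    have := hg |x' - y'| |x - y| (abs_nonneg _) hlt (by rw [abs_lt]; constructor <;> linarith)
    linarith

theorem spreadDecreasing_sEuc (m : ℝ) : SpreadDecreasing sEuc m := by
  refine spreadDecreasing_of_sub sEuc (fun x => x ^ 2 / 16) m (fun x hx _ => ?_) (fun x y => ?_)
    (fun x y hx hxy _ => ?_)
  · unfold sEuc; positivity
  · simp only [sEuc, sq_abs]; ring
  · have : x ^ 2 < y ^ 2 := by gcongr
    linarith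

theorem spreadDecreasing_sHyp (m : ℝ) : SpreadDecreasing sHyp m := by
  refine spreadDecreasing_of_sub sHyp (fun x => Real.cosh (x / 2) / 2) m (fun x hx _ => ?_)
    (fun x y => ?_) (fun x y hx hxy _ => ?_)
  · exact Real.sinh_pos_iff.2 (by positivity)
  · have : Real.cosh (|x - y| / 2) = Real.cosh (x / 2 - y / 2) := by
      rw [← sub_div, ← Real.cosh_abs ((x - y) / 2), abs_div, abs_two]
    simp only [sHyp, this, add_div, Real.cosh_add, Real.cosh_sub]; ring
  · have : Real.cosh (x / 2) < Real.cosh (y / 2) := by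
      rw [Real.cosh_lt_cosh, abs_of_nonneg (by linarith), abs_of_nonneg (by linarith)]; linarith
    linarith

theorem spreadDecreasing_sSph : SpreadDecreasing sSph (2 * Real.pi) := by
  refine spreadDecreasing_of_sub sSph (fun x => -Real.cos (x / 2) / 2) _ (fun x hx hx' => ?_)
    (fun x y => ?_) (fun x y hx hxy hy => ?_)
  · exact Real.sin_pos_of_pos_of_lt_pi (by linarith) (by linarith)
  · have : Real.cos (|x - y| / 2) = Real.cos (x / 2 - y / 2) := by
      rw [← sub_div, ← Real.cos_abs ((x - y) / 2), abs_div, abs_two]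
    simp only [sSph, this, add_div, Real.cos_add, Real.cos_sub]; ring
  · have : Real.cos (y / 2) < Real.cos (x / 2) :=
      Real.cos_lt_cos_of_nonneg_of_le_pi (by linarith) (by linarith) (by linarith)
    linarith

/-! ### A common model of spherical and hyperbolic geometry -/

/-- The common properties of `(cos, sin)` on `[0, π]` (with `σ = 1`) and of `(cosh, sinh)` on
`[0, ∞)` (with `σ = -1`). -/
structure IsTrigPair (σ : ℝ) (cs sn : ℝ → ℝ) (D : Set ℝ) : Prop where
  sign_sq : σ * σ = 1
  sq_add : ∀ t, cs t ^ 2 + σ * sn t ^ 2 = 1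
  cs_add : ∀ x y, cs (x + y) = cs x * cs y - σ * (sn x * sn y)
  sn_add : ∀ x y, sn (x + y) = sn x * cs y + cs x * sn y
  cs_zero : cs 0 = 1
  sn_zero : sn 0 = 0
  sn_neg : ∀ x, sn (-x) = -sn x
  hasDerivAt : ∀ x, HasDerivAt sn (cs x) x
  zero_mem : 0 ∈ D
  nonneg : ∀ x ∈ D, 0 ≤ x
  mem_of_le : ∀ x y, y ∈ D → 0 ≤ x → x ≤ y → x ∈ D
  sn_nonneg : ∀ x ∈ D, 0 ≤ sn x
  sn_pos : ∀ x y, y ∈ D → 0 < x → x < y → 0 < sn x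
  anti : StrictAntiOn (fun x => σ * cs x) D
  sign_or_pos : σ = 1 ∨ ∀ t, 0 < cs t

/-- A realization `φ` of a space with distance `d` in the unit quadric of a symmetric bilinear form
such that the form computes `cs` of the distance and is, up to the sign `σ`, positive on the
tangent spaces of the quadric. -/
structure IsQuadricModel {X V : Type} [AddCommGroup V] [Module ℝ V] (σ : ℝ) (cs sn : ℝ → ℝ)
    (D : Set ℝ) (b : V →ₗ[ℝ] V →ₗ[ℝ] ℝ) (φ : X → V) (d : X → X → ℝ) : Prop
    extends IsTrigPair σ cs sn D where
  form_symm : ∀ v w, b v w = b w v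
  dist_mem : ∀ P Q, d P Q ∈ D
  form_eq : ∀ P Q, b (φ P) (φ Q) = cs (d P Q)
  dist_self : ∀ P, d P P = 0
  dist_triangle : ∀ P Q Z, d P Z ≤ d P Q + d Q Z
  tangent_pos : ∀ P v, b v (φ P) = 0 → v ≠ 0 → 0 < σ * b v v
  exists_point : ∀ P v t, t ∈ D → b v v = 1 → b v (φ P) = cs t → ∃ Z, φ Z = v

theorem HasDerivAt.nonpos_of_max_left {g : ℝ → ℝ} {g' a : ℝ} (ha : 0 < a)
    (hg : HasDerivAt g g' 0) (hmax : ∀ t ∈ Set.Icc 0 a, g t ≤ g 0) : g' ≤ 0 := by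
  have h1 : IsLocalMaxOn g (Set.Icc 0 a) 0 := by
    filter_upwards [self_mem_nhdsWithin] with t ht using hmax t ht
  have h2 : a ∈ posTangentConeAt (Set.Icc (0 : ℝ) a) 0 := by
    apply mem_posTangentConeAt_of_segment_subset
    rw [zero_add, segment_eq_Icc ha.le]
  have h3 := h1.hasFDerivWithinAt_nonpos hg.hasFDerivAt.hasFDerivWithinAt h2
  simp at h3
  nlinarith

theorem HasDerivAt.eq_zero_of_max_Icc {g : ℝ → ℝ} {g' a t₀ : ℝ} (h0 : 0 < t₀) (h1 : t₀ < a)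
    (hg : HasDerivAt g g' t₀) (hmax : ∀ t ∈ Set.Icc 0 a, g t ≤ g t₀) : g' = 0 := by
  refine IsLocalMax.hasDerivAt_eq_zero (f := g) (a := t₀) ?_ hg
  filter_upwards [Icc_mem_nhds h0 h1] with t ht using hmax t ht

namespace IsTrigPair

variable {σ : ℝ} {cs sn : ℝ → ℝ} {D : Set ℝ}

theorem cs_neg (h : IsTrigPair σ cs sn D) (x : ℝ) : cs (-x) = cs x := by
  have h1 := h.cs_add x (-x)
  have h3 := h.sq_add x
  have h2 := h.sn_add x (-x)
  rw [add_neg_cancel, h.cs_zero, h.sn_neg] at h1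
  rw [add_neg_cancel, h.sn_zero, h.sn_neg] at h2
  linear_combination (-cs (-x)) * h3 - cs x * h1 - σ * sn x * h2

theorem cs_sub (h : IsTrigPair σ cs sn D) (x y : ℝ) :
    cs (x - y) = cs x * cs y + σ * (sn x * sn y) := by
  rw [sub_eq_add_neg, h.cs_add, h.cs_neg, h.sn_neg]; ring

theorem sn_sub (h : IsTrigPair σ cs sn D) (x y : ℝ) :
    sn (x - y) = sn x * cs y - cs x * sn y := by
  rw [sub_eq_add_neg, h.sn_add, h.cs_neg, h.sn_neg]; ring

theorem one_sub_cs (h : IsTrigPair σ cs sn D) (x : ℝ) :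
    1 - cs x = 2 * σ * sn (x / 2) ^ 2 := by
  have h1 := h.cs_add (x / 2) (x / 2)
  rw [add_halves] at h1
  linear_combination -h1 - h.sq_add (x / 2)

/-- For `a = d P Q`, `u = cs (d I P)` and `w = cs (d I Q)`, this function is `sn a` times `σ * cs`
of the distance from `I` to the point at distance `t` from `P` on the segment. It is largest where
that distance is smallest. -/
theorem hasDerivAt_arc (h : IsTrigPair σ cs sn D) (a u w t : ℝ) :
    HasDerivAt (fun t => σ * (sn (a - t) * u + sn t * w)) (σ * (-cs (a - t) * u + cs t * w)) t := by
  have h1 : HasDerivAt (fun t => sn (a - t)) (cs (a - t) * (-1)) t :=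
    (h.hasDerivAt (a - t)).comp t ((hasDerivAt_id t).const_sub a)
  have h2 := ((h1.mul_const u).add ((h.hasDerivAt t).mul_const w)).const_mul σ
  exact h2.congr_deriv (by ring)

theorem le_of_cs_le (h : IsTrigPair σ cs sn D) {x y : ℝ} (hx : x ∈ D) (hy : y ∈ D) (hxy : x ≤ y) :
    σ * cs y ≤ σ * cs x :=
  h.anti.antitoneOn hx hy hxy

theorem cs_injOn (h : IsTrigPair σ cs sn D) {x y : ℝ} (hx : x ∈ D) (hy : y ∈ D)
    (hxy : cs x = cs y) : x = y :=
  h.anti.injOn hx hy (by simp only [hxy])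

end IsTrigPair

/-! ### Geodesic segments and nearest points in a quadric model -/

namespace IsQuadricModel

variable {X V : Type} [AddCommGroup V] [Module ℝ V] {σ : ℝ} {cs sn : ℝ → ℝ}
  {D : Set ℝ} {b : V →ₗ[ℝ] V →ₗ[ℝ] ℝ} {φ : X → V} {d : X → X → ℝ}

theorem dist_comm (h : IsQuadricModel σ cs sn D b φ d) (P Q : X) : d P Q = d Q P :=
  h.cs_injOn (h.dist_mem _ _) (h.dist_mem _ _) (by rw [← h.form_eq, ← h.form_eq, h.form_symm])

theorem form_self (h : IsQuadricModel σ cs sn D b φ d) (P : X) : b (φ P) (φ P) = 1 := by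
  rw [h.form_eq, h.dist_self, h.cs_zero]

theorem eq_zero_of_tangent (h : IsQuadricModel σ cs sn D b φ d) {P : X} {v : V}
    (h1 : b v (φ P) = 0) (h2 : σ * b v v ≤ 0) : v = 0 := by
  by_contra hv
  exact absurd (h.tangent_pos P v h1 hv) (not_lt.2 h2)

/-- The difference of the two sides is tangent at `P` and has square `1 - cs ^ 2 = σ * sn ^ 2 = 0`,
so definiteness of the tangent space kills it. -/
theorem eq_smul_of_sn_eq_zero (h : IsQuadricModel σ cs sn D b φ d) {P Q : X}
    (h0 : sn (d P Q) = 0) : φ Q = cs (d P Q) • φ P := by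
  have h1 := h.sq_add (d P Q)
  have e1 := h.form_eq P Q
  have e2 := h.form_symm (φ P) (φ Q)
  refine sub_eq_zero.1 (h.eq_zero_of_tangent (P := P) ?_ (le_of_eq ?_))
  · simp only [map_sub, map_smul, LinearMap.sub_apply, LinearMap.smul_apply, smul_eq_mul,
      h.form_self, ← e2, e1]
    ring
  · simp only [map_sub, map_smul, LinearMap.sub_apply, LinearMap.smul_apply, smul_eq_mul,
      h.form_self, ← e2, e1]
    rw [h0] at h1
    linear_combination (-σ) * h1

theorem eq_of_dist_eq_zero (h : IsQuadricModel σ cs sn D b φ d) {P Q : X} (h0 : d P Q = 0) :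
    φ P = φ Q := by
  have := h.eq_smul_of_sn_eq_zero (P := P) (Q := Q) (by rw [h0, h.sn_zero])
  rw [this, h0, h.cs_zero, one_smul]

theorem geodSegment_comm (h : IsQuadricModel σ cs sn D b φ d) (P Q : X) :
    geodSegment d P Q = geodSegment d Q P := by
  ext Z
  simp only [geodSegment, Set.mem_ofPred_eq]
  rw [h.dist_comm P Z, h.dist_comm Z Q, h.dist_comm P Q, add_comm]

theorem left_mem_geodSegment (h : IsQuadricModel σ cs sn D b φ d) (P Q : X) :
    P ∈ geodSegment d P Q := by
  simp [geodSegment, h.dist_self]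

/-- By additivity of distances through `Z`, the difference of the two sides is a null vector tangent
at `Z`, hence zero. -/
theorem smul_eq_of_mem_geodSegment (h : IsQuadricModel σ cs sn D b φ d) {P Q Z : X}
    (hZ : Z ∈ geodSegment d P Q) :
    sn (d P Q) • φ Z = sn (d Z Q) • φ P + sn (d P Z) • φ Q := by
  have hZ' : d P Q = d P Z + d Z Q := hZ.symm
  have e1 := h.form_eq P Q
  have e2 := h.form_eq P Z
  have e3 := h.form_eq Z Q
  rw [hZ'] at e1 ⊢
  rw [h.cs_add] at e1
  rw [h.sn_add]
  have r1 := h.sq_add (d P Z)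
  have r2 := h.sq_add (d Z Q)
  refine (sub_eq_zero.1 (h.eq_zero_of_tangent (P := Z) ?_ (le_of_eq ?_))).symm
  · simp only [map_sub, map_add, map_smul, LinearMap.sub_apply, LinearMap.add_apply,
      LinearMap.smul_apply, smul_eq_mul, h.form_self, h.form_symm (φ Q) (φ Z), e2, e3]
    ring
  · simp only [map_sub, map_add, map_smul, LinearMap.sub_apply, LinearMap.add_apply,
      LinearMap.smul_apply, smul_eq_mul, h.form_self, h.form_symm (φ Q) (φ Z),
      h.form_symm (φ Z) (φ P), h.form_symm (φ Q) (φ P), e1, e2, e3]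
    generalize cs (d P Z) = C1 at *
    generalize sn (d P Z) = S1 at *
    generalize cs (d Z Q) = C2 at *
    generalize sn (d Z Q) = S2 at *
    have hs := h.sign_sq
    grind

theorem exists_mem_geodSegment (h : IsQuadricModel σ cs sn D b φ d) {P Q : X}
    (hS : 0 < sn (d P Q)) {t : ℝ} (ht : t ∈ Set.Icc 0 (d P Q)) :
    ∃ Z ∈ geodSegment d P Q, sn (d P Q) • φ Z = sn (d P Q - t) • φ P + sn t • φ Q := by
  have e1 := h.form_eq P Q
  have hD := h.dist_mem P Q
  have htD := h.mem_of_le _ _ hD ht.1 ht.2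
  have r1 := h.sq_add (d P Q)
  have r2 := h.sq_add t
  have s1 := h.sn_sub (d P Q) t
  have s2 := h.cs_sub (d P Q) t
  have hs := h.sign_sq
  obtain ⟨Z, hZ⟩ := h.exists_point P
    ((sn (d P Q))⁻¹ • (sn (d P Q - t) • φ P + sn t • φ Q)) t htD (by
      simp only [map_add, map_smul, LinearMap.add_apply,
        LinearMap.smul_apply, smul_eq_mul, h.form_self, h.form_symm (φ Q) (φ P), e1, s1]
      have := hS.ne'
      field_simp
      grind) (by
      simp only [map_add, map_smul, LinearMap.add_apply,
        LinearMap.smul_apply, smul_eq_mul, h.form_self, h.form_symm (φ Q) (φ P), e1, s1]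
      field_simp
      ring)
  have hZ' : sn (d P Q) • φ Z = sn (d P Q - t) • φ P + sn t • φ Q := by
    rw [hZ, smul_inv_smul₀ hS.ne']
  refine ⟨Z, ?_, hZ'⟩
  have h1 : d P Z = t := by
    refine h.cs_injOn (h.dist_mem _ _) htD ?_
    have := congrArg (b (φ P)) hZ'
    simp only [map_add, map_smul, smul_eq_mul, h.form_self, h.form_eq P Z, e1, s1] at this
    refine mul_left_cancel₀ hS.ne' ?_
    linear_combination this
  have h2 : d Z Q = d P Q - t := by
    refine h.cs_injOn (h.dist_mem _ _) (h.mem_of_le _ _ hD (by linarith [ht.2])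
      (by linarith [ht.1])) ?_
    have := congrArg (b (φ Q)) hZ'
    simp only [map_add, map_smul, smul_eq_mul, h.form_self, h.form_symm (φ Q) (φ P),
      h.form_symm (φ Q) (φ Z), h.form_eq Z Q, e1, s1] at this
    refine mul_left_cancel₀ hS.ne' ?_
    linear_combination this - sn (d P Q) * s2 - sn t * r1
  simp only [geodSegment, Set.mem_ofPred_eq]
  rw [h1, h2]
  ring

/-- The value `r` of the distance from `I` to a side satisfies a maximum property along the side. -/
theorem arc_le_of_isLeast (h : IsQuadricModel σ cs sn D b φ d) {P Q I : X} {r : ℝ}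
    (hS : 0 < sn (d P Q)) (hr : IsLeast (d I '' geodSegment d P Q) r) {t : ℝ}
    (ht : t ∈ Set.Icc 0 (d P Q)) :
    σ * (sn (d P Q - t) * cs (d I P) + sn t * cs (d I Q)) ≤ sn (d P Q) * (σ * cs r) := by
  obtain ⟨Z, hZ, hZ'⟩ := h.exists_mem_geodSegment hS ht
  have h1 := hr.2 ⟨Z, hZ, rfl⟩
  obtain ⟨Z₀, -, hZ₀⟩ := hr.1
  have h2 := h.le_of_cs_le (hZ₀ ▸ h.dist_mem _ _) (h.dist_mem _ _) h1
  have := congrArg (b (φ I)) hZ'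
  simp only [map_add, map_smul, smul_eq_mul, h.form_eq] at this
  rw [← this]
  nlinarith

/-- For `F t = sn (d P Q - t) * cs (d I P) + sn t * cs (d I Q)`, the quantity `F' ^ 2 + σ * F ^ 2`
is constant and equals the right-hand side. At an interior nearest point `F' = 0` and `F = sn (d P
Q) * cs r`. The other alternatives cover a nearest point at an end. -/
theorem edge_of_isLeast (h : IsQuadricModel σ cs sn D b φ d) {P Q I : X} {r : ℝ}
    (hS : 0 < sn (d P Q)) (hr : IsLeast (d I '' geodSegment d P Q) r) :
    cs r ^ 2 * (1 - cs (d P Q) ^ 2) = cs (d I P) ^ 2 + cs (d I Q) ^ 2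
      - 2 * cs (d P Q) * cs (d I P) * cs (d I Q) ∨ d I P = r ∨ d I Q = r := by
  obtain ⟨Z, hZ, rfl⟩ := hr.1
  have hZ1 : d P Z + d Z Q = d P Q := hZ
  have hZ2 := congrArg (b (φ I)) (h.smul_eq_of_mem_geodSegment hZ)
  simp only [map_add, map_smul, smul_eq_mul, h.form_eq] at hZ2
  rcases (h.nonneg _ (h.dist_mem P Z)).eq_or_lt with h0 | h0
  · right; left
    have := h.eq_of_dist_eq_zero h0.symm
    exact h.cs_injOn (h.dist_mem _ _) (h.dist_mem _ _) (by rw [← h.form_eq, ← h.form_eq, this])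
  rcases (h.nonneg _ (h.dist_mem Z Q)).eq_or_lt with h0' | h0'
  · right; right
    have := h.eq_of_dist_eq_zero h0'.symm
    exact h.cs_injOn (h.dist_mem _ _) (h.dist_mem _ _) (by rw [← h.form_eq, ← h.form_eq, this])
  left
  have hd := HasDerivAt.eq_zero_of_max_Icc h0 (by linarith : d P Z < d P Q)
    (h.hasDerivAt_arc (d P Q) (cs (d I P)) (cs (d I Q)) (d P Z)) (fun t ht => by
      have := h.arc_le_of_isLeast hS hr ht
      have e : d P Q - d P Z = d Z Q := by linarith
      rw [e]
      linear_combination this + σ * hZ2)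
  have e : d P Q - d P Z = d Z Q := by linarith
  rw [e] at hd
  have hs := h.sign_sq
  have hd' : -cs (d Z Q) * cs (d I P) + cs (d P Z) * cs (d I Q) = 0 := by
    linear_combination σ * hd - (-cs (d Z Q) * cs (d I P) + cs (d P Z) * cs (d I Q)) * hs
  have r0 := h.sq_add (d P Q)
  have r1 := h.sq_add (d P Z)
  have r2 := h.sq_add (d Z Q)
  have r3 := h.cs_add (d P Z) (d Z Q)
  rw [hZ1] at r3
  linear_combination (-cs (d I Z) ^ 2) * r0 +
    σ * (sn (d P Q) * cs (d I Z) + (sn (d Z Q) * cs (d I P) + sn (d P Z) * cs (d I Q))) * hZ2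
    - (-cs (d Z Q) * cs (d I P) + cs (d P Z) * cs (d I Q)) * hd'
    + cs (d I P) ^ 2 * r2 + cs (d I Q) ^ 2 * r1 + 2 * cs (d I P) * cs (d I Q) * r3

theorem deriv_nonpos_of_isLeast (h : IsQuadricModel σ cs sn D b φ d) {P Q I : X} {r : ℝ}
    (hS : 0 < sn (d P Q)) (hr : IsLeast (d I '' geodSegment d P Q) r) (hP : d I P = r) :
    σ * (cs (d I Q) - cs (d P Q) * cs (d I P)) ≤ 0 := by
  have hpos : 0 < d P Q := by
    refine (h.nonneg _ (h.dist_mem P Q)).lt_of_ne fun e => ?_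
    rw [← e, h.sn_zero] at hS
    exact lt_irrefl _ hS
  have := HasDerivAt.nonpos_of_max_left hpos
    (h.hasDerivAt_arc (d P Q) (cs (d I P)) (cs (d I Q)) 0) (fun t ht => by
      have := h.arc_le_of_isLeast hS hr ht
      rw [sub_zero, h.sn_zero, hP]
      rw [hP] at this
      linarith)
  rw [sub_zero, h.cs_zero] at this
  linarith

end IsQuadricModel

/-! ### Half-perimeter identities -/

namespace IsTrigPair

variable {σ : ℝ} {cs sn : ℝ → ℝ} {D : Set ℝ}

/-- A Heron formula: with sides `v + w`, `u + w`, `u + v`, the left side is the Gram determinant of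
the vertices. -/
theorem gram_eq (h : IsTrigPair σ cs sn D) (u v w : ℝ) :
    1 + 2 * cs (v + w) * cs (u + w) * cs (u + v) - cs (v + w) ^ 2 - cs (u + w) ^ 2
      - cs (u + v) ^ 2 = 4 * sn (u + v + w) * (sn u * sn v * sn w) := by
  have hσ := h.sign_sq
  have hu := h.sq_add u
  have hv := h.sq_add v
  have hw := h.sq_add w
  rw [h.sn_add (u + v) w, h.cs_add u v, h.cs_add v w, h.cs_add u w, h.sn_add u v]
  generalize cs u = Cu at *
  generalize cs v = Cv at *
  generalize cs w = Cw at *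
  generalize sn u = Su at *
  generalize sn v = Sv at *
  generalize sn w = Sw at *
  grind

/-- The left side is the square of the unnormalized incentre, the sum of the vertices weighted by
`sn` of the opposite sides. -/
theorem incenter_form_eq (h : IsTrigPair σ cs sn D) (u v w : ℝ) :
    sn (v + w) ^ 2 + sn (u + w) ^ 2 + sn (u + v) ^ 2 + 2 * sn (u + w) * sn (u + v) * cs (v + w)
      + 2 * sn (v + w) * sn (u + v) * cs (u + w) + 2 * sn (v + w) * sn (u + w) * cs (u + v) =
    4 * sn (u + v + w) * (sn (u + v + w) + σ * (sn u * sn v * sn w)) := by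
  have hσ := h.sign_sq
  have hu := h.sq_add u
  have hv := h.sq_add v
  have hw := h.sq_add w
  rw [h.sn_add (u + v) w, h.cs_add u v, h.cs_add v w, h.cs_add u w, h.sn_add u v, h.sn_add u w,
    h.sn_add v w]
  generalize cs u = Cu at *
  generalize cs v = Cv at *
  generalize cs w = Cw at *
  generalize sn u = Su at *
  generalize sn v = Sv at *
  generalize sn w = Sw at *
  grind

end IsTrigPair

/-! ### Nondegenerate triangles and the position of the incentre -/

namespace IsQuadricModel

variable {X V : Type} [AddCommGroup V] [Module ℝ V] {σ : ℝ} {cs sn : ℝ → ℝ}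
  {D : Set ℝ} {b : V →ₗ[ℝ] V →ₗ[ℝ] ℝ} {φ : X → V} {d : X → X → ℝ}

/-- The linear independence of three vectors, in coordinates. -/
def Indep (A B C : V) : Prop :=
  ∀ α β γ : ℝ, α • A + β • B + γ • C = 0 → α = 0 ∧ β = 0 ∧ γ = 0


theorem Indep.rotate {A B C : V} (h : Indep A B C) : Indep B C A := fun α β γ e => by
  obtain ⟨h1, h2, h3⟩ := h γ α β (by rw [← e]; abel)
  exact ⟨h2, h3, h1⟩

theorem Indep.swap {A B C : V} (h : Indep A B C) : Indep A C B := fun α β γ e => by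
  obtain ⟨h1, h2, h3⟩ := h α γ β (by rw [← e]; abel)
  exact ⟨h1, h3, h2⟩

theorem sn_dist_pos (h : IsQuadricModel σ cs sn D b φ d) {A B C : X}
    (hi : Indep (φ A) (φ B) (φ C)) : 0 < sn (d B C) := by
  refine (h.sn_nonneg _ (h.dist_mem _ _)).lt_of_ne fun e => ?_
  have h1 := h.eq_smul_of_sn_eq_zero e.symm
  have := (hi 0 (cs (d B C)) (-1) (by rw [h1]; module)).2.2
  norm_num at this

theorem exists_of_mem_geodSegment (h : IsQuadricModel σ cs sn D b φ d) {P Q Z : X}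
    (hS : 0 < sn (d P Q)) (hZ : Z ∈ geodSegment d P Q) :
    ∃ β γ : ℝ, 0 ≤ β ∧ 0 ≤ γ ∧ φ Z = β • φ P + γ • φ Q := by
  refine ⟨(sn (d P Q))⁻¹ * sn (d Z Q), (sn (d P Q))⁻¹ * sn (d P Z),
    mul_nonneg (inv_nonneg.2 hS.le) (h.sn_nonneg _ (h.dist_mem _ _)),
    mul_nonneg (inv_nonneg.2 hS.le) (h.sn_nonneg _ (h.dist_mem _ _)), ?_⟩
  rw [mul_smul, mul_smul, ← smul_add, ← h.smul_eq_of_mem_geodSegment hZ, inv_smul_smul₀ hS.ne']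

theorem notMem_geodSegment (h : IsQuadricModel σ cs sn D b φ d) {A B C : X}
    (hi : Indep (φ A) (φ B) (φ C)) : A ∉ geodSegment d B C := fun hA => by
  obtain ⟨β, γ, -, -, e⟩ := h.exists_of_mem_geodSegment (h.sn_dist_pos hi) hA
  have := (hi (-1) β γ (by rw [e]; module)).1
  norm_num at this

theorem dist_lt (h : IsQuadricModel σ cs sn D b φ d) {A B C : X}
    (hi : Indep (φ A) (φ B) (φ C)) : d B C < d C A + d A B := by
  have h1 := h.dist_triangle B A C
  have h2 := h.dist_comm B A
  have h3 := h.dist_comm A C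
  refine lt_of_le_of_ne (by linarith) fun e => h.notMem_geodSegment hi ?_
  simp only [geodSegment, Set.mem_ofPred_eq]
  linarith

theorem exists_of_mem_filledTriangle (h : IsQuadricModel σ cs sn D b φ d) {A B C I : X}
    (hi : Indep (φ A) (φ B) (φ C)) (hI : I ∈ filledTriangle d A B C) :
    ∃ α β γ : ℝ, 0 ≤ α ∧ 0 ≤ β ∧ 0 ≤ γ ∧ φ I = α • φ A + β • φ B + γ • φ C := by
  obtain ⟨E, hE, hIE⟩ := hI
  obtain ⟨β, γ, hβ, hγ, e⟩ := h.exists_of_mem_geodSegment (h.sn_dist_pos hi) hE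
  have hS : 0 < sn (d A E) := by
    refine (h.sn_nonneg _ (h.dist_mem _ _)).lt_of_ne fun e0 => ?_
    have h1 := h.eq_smul_of_sn_eq_zero e0.symm
    obtain ⟨h2, h3, h4⟩ := hi (cs (d A E)) (-β) (-γ) (by rw [← h1, e]; module)
    have h5 := h.sq_add (d A E)
    rw [← e0, h2] at h5
    norm_num at h5
  obtain ⟨α, δ, hα, hδ, e'⟩ := h.exists_of_mem_geodSegment hS hIE
  exact ⟨α, δ * β, δ * γ, hα, mul_nonneg hδ hβ, mul_nonneg hδ hγ, by rw [e', e]; module⟩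

/-- The centre of the inscribed circle does not have a vertex as nearest point of a side. -/
theorem dist_vertex_ne (h : IsQuadricModel σ cs sn D b φ d) {A B C I : X} {r α β γ : ℝ}
    (hi : Indep (φ A) (φ B) (φ C)) (hα : 0 ≤ α) (hβ : 0 ≤ β) (hγ : 0 ≤ γ)
    (hI : φ I = α • φ A + β • φ B + γ • φ C)
    (h1 : IsLeast (d I '' geodSegment d B C) r) (h2 : IsLeast (d I '' geodSegment d C A) r)
    (h3 : IsLeast (d I '' geodSegment d A B) r) : d I B ≠ r := fun hr => by
  have s1 := h.deriv_nonpos_of_isLeast (h.sn_dist_pos hi) h1 hr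
  rw [h.geodSegment_comm] at h3
  have s3 := h.deriv_nonpos_of_isLeast (h.sn_dist_pos hi.rotate.rotate.swap) h3 hr
  -- Up to a factor, this is the tangent direction from `B` to `I`. It is a nonnegative combination
  -- of the directions to `A` and `C`, while `s1` and `s3` say that it makes no acute angle with
  -- either; so its `σ`-square is at most zero.
  have hz : φ I - cs (d I B) • φ B = 0 := by
    refine h.eq_zero_of_tangent (P := B) ?_ ?_
    · simp only [map_sub, map_smul, LinearMap.sub_apply, LinearMap.smul_apply, smul_eq_mul,
        h.form_self, h.form_eq I B]
      ring
    · have e0 : b (φ I - cs (d I B) • φ B) (φ B) = 0 := by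
        simp only [map_sub, map_smul, LinearMap.sub_apply, LinearMap.smul_apply, smul_eq_mul,
          h.form_self, h.form_eq I B]
        ring
      have e1 : b (φ I - cs (d I B) • φ B) (φ I - cs (d I B) • φ B) =
          α * (cs (d I A) - cs (d B A) * cs (d I B)) +
          γ * (cs (d I C) - cs (d B C) * cs (d I B)) := by
        rw [map_sub, map_smul, e0]
        nth_rw 2 [hI]
        simp only [map_add, map_smul, map_sub, LinearMap.sub_apply, LinearMap.smul_apply,
          smul_eq_mul, h.form_eq]
        rw [h.form_symm] at e0
        have e0' := h.form_self B
        rw [h.form_eq] at e0'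
        rw [e0']
        ring
      rw [e1]
      nlinarith [mul_nonneg hα (neg_nonneg.2 s3), mul_nonneg hγ (neg_nonneg.2 s1)]
  rw [hI] at hz
  obtain ⟨ha, -, hc⟩ := hi α (β - cs (d I B)) γ (by rw [← hz]; module)
  rw [ha, hc, zero_smul, zero_smul, zero_add, add_zero] at hI
  have hsq : β * β = 1 := by
    have := h.form_self I
    rw [hI] at this
    simpa only [map_smul, LinearMap.smul_apply, smul_eq_mul, h.form_self, mul_one] using this
  have hβ1 : β = 1 := by nlinarith
  rw [hβ1, one_smul] at hI
  have h0 : d I B = 0 := h.cs_injOn (h.dist_mem _ _) h.zero_mem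
    (by rw [← h.form_eq, hI, h.form_self, h.cs_zero])
  -- Now `I` coincides with `B` and `r = 0`, so the side `CA` would contain the opposite vertex.
  obtain ⟨Z, hZ, hZr⟩ := h2.1
  have hIZ := h.eq_of_dist_eq_zero (hZr.trans (hr.symm.trans h0))
  obtain ⟨p, q, -, -, e⟩ := h.exists_of_mem_geodSegment (h.sn_dist_pos hi.rotate) hZ
  have := (hi q (-1) p (by rw [← hI, hIZ, e]; module)).2.1
  norm_num at this

/-- The Gram determinant of the vertices. -/
def gram (cs : ℝ → ℝ) (a b c : ℝ) : ℝ :=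
  1 + 2 * cs a * cs b * cs c - cs a ^ 2 - cs b ^ 2 - cs c ^ 2

theorem gram_pos (h : IsQuadricModel σ cs sn D b φ d) {A B C : X}
    (hi : Indep (φ A) (φ B) (φ C)) : 0 < gram cs (d B C) (d C A) (d A B) := by
  have hs := h.sn_dist_pos hi
  have e := h.sq_add (d B C)
  have hσ := h.sign_sq
  set x := cs (d B C) with hx
  set y := cs (d C A) with hy
  set z := cs (d A B) with hz
  have bx : b (φ B) (φ C) = x := h.form_eq _ _
  have bx' : b (φ C) (φ B) = x := by rw [h.form_symm, bx]
  have bY : b (φ C) (φ A) = y := h.form_eq _ _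
  have bY' : b (φ A) (φ C) = y := by rw [h.form_symm, bY]
  have bz : b (φ A) (φ B) = z := h.form_eq _ _
  have bz' : b (φ B) (φ A) = z := by rw [h.form_symm, bz]
  -- This is `1 - x ^ 2` times the component of `φ A` orthogonal to `φ B` and `φ C`; its square is
  -- `(1 - x ^ 2)` times the Gram determinant.
  have key := h.tangent_pos B ((1 - x ^ 2) • φ A - (z - x * y) • φ B - (y - x * z) • φ C)
    (by
      simp only [map_sub, map_smul, LinearMap.sub_apply, LinearMap.smul_apply, smul_eq_mul,
        h.form_self, bx', bz]
      ring)
    (fun h0 => by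
      have := (hi (1 - x ^ 2) (-(z - x * y)) (-(y - x * z)) (by rw [← h0]; module)).1
      have h2 : σ * sn (d B C) ^ 2 = 0 := by linarith
      have h3 : sn (d B C) ^ 2 = 0 := by linear_combination σ * h2 - sn (d B C) ^ 2 * hσ
      have : 0 < sn (d B C) ^ 2 := by positivity
      linarith)
  simp only [map_sub, map_smul, LinearMap.sub_apply, LinearMap.smul_apply, smul_eq_mul,
    h.form_self, bx, bx', bY, bY', bz, bz'] at key
  have e2 : 1 - x ^ 2 = σ * sn (d B C) ^ 2 := by linarith
  have : 0 < sn (d B C) ^ 2 * gram cs (d B C) (d C A) (d A B) := by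
    refine lt_of_lt_of_eq key ?_
    rw [gram, ← hx, ← hy, ← hz]
    linear_combination σ * (1 + 2 * x * y * z - x ^ 2 - y ^ 2 - z ^ 2) * e2 +
      sn (d B C) ^ 2 * (1 + 2 * x * y * z - x ^ 2 - y ^ 2 - z ^ 2) * hσ
  exact pos_of_mul_pos_right this (by positivity)

end IsQuadricModel

/-! ### Formulas for the inradius and the circumradius -/

namespace IsQuadricModel

variable {X V : Type} [AddCommGroup V] [Module ℝ V] {σ : ℝ} {cs sn : ℝ → ℝ}
  {D : Set ℝ} {b : V →ₗ[ℝ] V →ₗ[ℝ] ℝ} {φ : X → V} {d : X → X → ℝ}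

theorem gram_rotate (cs : ℝ → ℝ) (a b c : ℝ) : gram cs b c a = gram cs a b c := by
  simp only [gram]; ring

theorem cs_dist_eq (h : IsQuadricModel σ cs sn D b φ d) {A B C I : X} {α β γ : ℝ}
    (hI : φ I = α • φ A + β • φ B + γ • φ C) :
    cs (d I A) = α + β * cs (d A B) + γ * cs (d C A) := by
  have := h.form_eq I A
  rw [hI] at this
  simp only [map_add, map_smul, LinearMap.add_apply, LinearMap.smul_apply, smul_eq_mul,
    h.form_self, h.form_symm (φ B) (φ A), h.form_eq A B, h.form_eq C A] at this
  linarith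

theorem norm_eq_one (h : IsQuadricModel σ cs sn D b φ d) {A B C I : X} {α β γ : ℝ}
    (hI : φ I = α • φ A + β • φ B + γ • φ C) :
    α * cs (d I A) + β * cs (d I B) + γ * cs (d I C) = 1 := by
  have := h.form_self I
  nth_rw 2 [hI] at this
  simpa only [map_add, map_smul, smul_eq_mul, h.form_eq] using this

theorem rotate_comb {A B C W : V} {α β γ : ℝ} (hI : W = α • A + β • B + γ • C) :
    W = β • B + γ • C + α • A := by rw [hI]; abel

/-- Both sides are the Gram determinant of `I`, `B`, `C`, up to sign conventions: once as squared
base times squared height, once through the coordinate `α` of `I` along `A`. -/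
theorem sn_sq_mul_of_edge (h : IsQuadricModel σ cs sn D b φ d) {A B C I : X} {r α β γ : ℝ}
    (hI : φ I = α • φ A + β • φ B + γ • φ C)
    (he : cs r ^ 2 * (1 - cs (d B C) ^ 2) = cs (d I B) ^ 2 + cs (d I C) ^ 2
      - 2 * cs (d B C) * cs (d I B) * cs (d I C)) :
    sn r ^ 2 * sn (d B C) ^ 2 = α ^ 2 * gram cs (d B C) (d C A) (d A B) := by
  have h1 := h.norm_eq_one hI
  rw [h.cs_dist_eq hI, h.cs_dist_eq (rotate_comb hI),
    h.cs_dist_eq (rotate_comb (rotate_comb hI))] at h1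
  rw [h.cs_dist_eq (rotate_comb hI), h.cs_dist_eq (rotate_comb (rotate_comb hI))] at he
  have r1 := h.sq_add r
  have r2 := h.sq_add (d B C)
  have hσ := h.sign_sq
  have e1 : sn r ^ 2 * sn (d B C) ^ 2 = (1 - cs r ^ 2) * (1 - cs (d B C) ^ 2) := by
    rw [show 1 - cs r ^ 2 = σ * sn r ^ 2 by linarith,
      show 1 - cs (d B C) ^ 2 = σ * sn (d B C) ^ 2 by linarith]
    linear_combination (-(sn r ^ 2 * sn (d B C) ^ 2)) * hσ
  rw [e1, gram]
  linear_combination -he - (1 - cs (d B C) ^ 2) * h1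

theorem isInscribed_aux (h : IsQuadricModel σ cs sn D b φ d) {A B C I : X} {r : ℝ}
    (hi : Indep (φ A) (φ B) (φ C)) (hr : IsInscribedCircle d A B C I r) :
    ∃ α β γ : ℝ, 0 ≤ α ∧ 0 ≤ β ∧ 0 ≤ γ ∧ φ I = α • φ A + β • φ B + γ • φ C ∧
      sn r ^ 2 * sn (d B C) ^ 2 = α ^ 2 * gram cs (d B C) (d C A) (d A B) ∧
      sn r ^ 2 * sn (d C A) ^ 2 = β ^ 2 * gram cs (d B C) (d C A) (d A B) ∧
      sn r ^ 2 * sn (d A B) ^ 2 = γ ^ 2 * gram cs (d B C) (d C A) (d A B) := by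
  obtain ⟨hT, h1, h2, h3⟩ := hr
  obtain ⟨α, β, γ, hα, hβ, hγ, hI⟩ := h.exists_of_mem_filledTriangle hi hT
  have hI' := rotate_comb hI
  have hI'' := rotate_comb hI'
  have nB := h.dist_vertex_ne hi hα hβ hγ hI h1 h2 h3
  have nC := h.dist_vertex_ne hi.rotate hβ hγ hα hI' h2 h3 h1
  have nA := h.dist_vertex_ne hi.rotate.rotate hγ hα hβ hI'' h3 h1 h2
  refine ⟨α, β, γ, hα, hβ, hγ, hI, ?_, ?_, ?_⟩
  · exact h.sn_sq_mul_of_edge hI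
      ((h.edge_of_isLeast (h.sn_dist_pos hi) h1).resolve_right (by tauto))
  · rw [← gram_rotate]
    exact h.sn_sq_mul_of_edge hI'
      ((h.edge_of_isLeast (h.sn_dist_pos hi.rotate) h2).resolve_right (by tauto))
  · rw [← gram_rotate, ← gram_rotate]
    exact h.sn_sq_mul_of_edge hI''
      ((h.edge_of_isLeast (h.sn_dist_pos hi.rotate.rotate) h3).resolve_right (by tauto))

/-- Only the sphere needs an argument: `r` is at most the distance to each vertex, so `1 = b (φ I)
(φ I) ≤ (α + β + γ) * cs r`. -/
theorem cs_inradius_pos (h : IsQuadricModel σ cs sn D b φ d) {A B C I : X} {r : ℝ}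
    (hi : Indep (φ A) (φ B) (φ C)) (hr : IsInscribedCircle d A B C I r) : 0 < cs r := by
  rcases h.sign_or_pos with hσ | hcs
  swap
  · exact hcs r
  obtain ⟨hT, h1, h2, h3⟩ := hr
  obtain ⟨α, β, γ, hα, hβ, hγ, hI⟩ := h.exists_of_mem_filledTriangle hi hT
  have hrD : r ∈ D := by
    obtain ⟨Z, -, hZ⟩ := h1.1
    exact hZ ▸ h.dist_mem _ _
  have hle : ∀ {P Q : X}, IsLeast (d I '' geodSegment d P Q) r → cs (d I P) ≤ cs r :=
    fun {P Q} hl => by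
      have := h.le_of_cs_le hrD (h.dist_mem _ _) (hl.2 ⟨P, h.left_mem_geodSegment P Q, rfl⟩)
      rwa [hσ, one_mul, one_mul] at this
  by_contra hneg
  have := h.norm_eq_one hI
  nlinarith [mul_le_mul_of_nonneg_left (hle h3) hα, mul_le_mul_of_nonneg_left (hle h1) hβ,
    mul_le_mul_of_nonneg_left (hle h2) hγ, mul_nonneg hα (neg_nonneg.2 (not_lt.1 hneg)),
    mul_nonneg hβ (neg_nonneg.2 (not_lt.1 hneg)), mul_nonneg hγ (neg_nonneg.2 (not_lt.1 hneg))]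

theorem dist_half_pos (h : IsQuadricModel σ cs sn D b φ d) {A B C : X}
    (hi : Indep (φ A) (φ B) (φ C)) : 0 < sn ((d C A + d A B - d B C) / 2) := by
  have h1 := h.dist_lt hi
  have h2 := h.dist_lt hi.rotate.rotate
  exact h.sn_pos _ (d C A) (h.dist_mem _ _) (by linarith) (by linarith)

/-- The formula for the inradius. -/
theorem sn_inradius_sq (h : IsQuadricModel σ cs sn D b φ d) {A B C I : X} {r u v w : ℝ}
    (hi : Indep (φ A) (φ B) (φ C)) (hr : IsInscribedCircle d A B C I r)
    (ha : d B C = v + w) (hb : d C A = u + w) (hc : d A B = u + v) :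
    sn r ^ 2 * sn (u + v + w) = cs r ^ 2 * (sn u * sn v * sn w) := by
  obtain ⟨α, β, γ, hα, hβ, hγ, hI, e1, e2, e3⟩ := h.isInscribed_aux hi hr
  have hG := h.gram_pos hi
  have hG' : gram cs (d B C) (d C A) (d A B) = 4 * sn (u + v + w) * (sn u * sn v * sn w) := by
    rw [gram, ha, hb, hc, ← h.gram_eq u v w]
  have hr0 : 0 ≤ sn r := by
    obtain ⟨Z, -, hZ⟩ := hr.2.1.1
    exact h.sn_nonneg _ (hZ ▸ h.dist_mem _ _)
  set G := gram cs (d B C) (d C A) (d A B) with hGdef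
  have p1 := (h.sn_dist_pos hi).le
  have p2 := (h.sn_dist_pos hi.rotate).le
  have p3 := (h.sn_dist_pos hi.rotate.rotate).le
  have hroot : ∀ {t s : ℝ}, 0 ≤ t → 0 ≤ s → sn r ^ 2 * s ^ 2 = t ^ 2 * G →
      t * √G = sn r * s := fun {t s} ht hs e => by
    refine (sq_eq_sq₀ (mul_nonneg ht (Real.sqrt_nonneg _)) (mul_nonneg hr0 hs)).1 ?_
    rw [mul_pow, Real.sq_sqrt hG.le, mul_pow, e]
  have f1 := hroot hα p1 e1
  have f2 := hroot hβ p2 e2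
  have f3 := hroot hγ p3 e3
  have hn := h.norm_eq_one hI
  rw [h.cs_dist_eq hI, h.cs_dist_eq (rotate_comb hI),
    h.cs_dist_eq (rotate_comb (rotate_comb hI))] at hn
  have hN : sn (d B C) ^ 2 + sn (d C A) ^ 2 + sn (d A B) ^ 2
      + 2 * sn (d C A) * sn (d A B) * cs (d B C) + 2 * sn (d B C) * sn (d A B) * cs (d C A)
      + 2 * sn (d B C) * sn (d C A) * cs (d A B) =
      4 * sn (u + v + w) * (sn (u + v + w) + σ * (sn u * sn v * sn w)) := by
    rw [ha, hb, hc, h.incenter_form_eq]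
  have hsq := Real.sq_sqrt hG.le
  -- The unit norm of `φ I`, multiplied by `G`, with each coordinate times `√G` replaced by `sn r`
  -- times `sn` of the opposite side.
  have key : G = sn r ^ 2 * (4 * sn (u + v + w) *
      (sn (u + v + w) + σ * (sn u * sn v * sn w))) := by
    rw [← hN]
    calc G = (√G) ^ 2 * 1 := by rw [hsq, mul_one]
      _ = (α * √G) ^ 2 + (β * √G) ^ 2 + (γ * √G) ^ 2
        + 2 * (β * √G) * (γ * √G) * cs (d B C) + 2 * (α * √G) * (γ * √G) * cs (d C A)
        + 2 * (α * √G) * (β * √G) * cs (d A B) := by rw [← hn]; ring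
      _ = _ := by rw [f1, f2, f3]; ring
  rw [hG'] at key hG
  have h0 : sn (u + v + w) ≠ 0 := by
    rintro e
    rw [e] at hG
    simp at hG
  have key' : sn u * sn v * sn w = sn r ^ 2 * (sn (u + v + w) + σ * (sn u * sn v * sn w)) := by
    refine mul_left_cancel₀ (mul_ne_zero four_ne_zero h0) ?_
    linear_combination key
  linear_combination -key' - (sn u * sn v * sn w) * h.sq_add r

/-- The formula for the circumradius. -/
theorem sn_circumradius_sq (h : IsQuadricModel σ cs sn D b φ d) {A B C O : X} {R : ℝ}
    (hspan : ∀ W : V, ∃ p q s : ℝ, W = p • φ A + q • φ B + s • φ C)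
    (hR : IsCircumscribedCircle d A B C O R) :
    sn R ^ 2 * gram cs (d B C) (d C A) (d A B) =
      16 * cs R ^ 2 * (sn (d B C / 2) * sn (d C A / 2) * sn (d A B / 2)) ^ 2 := by
  obtain ⟨h1, h2, h3⟩ := hR
  obtain ⟨p, q, s, hO⟩ := hspan (φ O)
  have e1 := h.cs_dist_eq hO
  have e2 := h.cs_dist_eq (rotate_comb hO)
  have e3 := h.cs_dist_eq (rotate_comb (rotate_comb hO))
  have hn := h.norm_eq_one hO
  rw [h1] at e1 hn
  rw [h2] at e2 hn
  rw [h3] at e3 hn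
  have i1 := h.one_sub_cs (d B C)
  have i2 := h.one_sub_cs (d C A)
  have i3 := h.one_sub_cs (d A B)
  have r1 := h.sq_add R
  have hσ := h.sign_sq
  have key : (1 - cs R ^ 2) * gram cs (d B C) (d C A) (d A B) =
      2 * cs R ^ 2 * ((1 - cs (d B C)) * (1 - cs (d C A)) * (1 - cs (d A B))) := by
    rw [gram]
    generalize cs (d B C) = x at *
    generalize cs (d C A) = y at *
    generalize cs (d A B) = z at *
    generalize cs R = k at *
    -- The coefficients of `e1`, `e2`, `e3` contain the row sums of the adjugate of the Gram matrix;
    -- this eliminates the coordinates of `O`.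
    linear_combination -k * ((1 - x ^ 2) + (x * y - z) + (x * z - y)) * e1
      - k * ((x * y - z) + (1 - y ^ 2) + (y * z - x)) * e2
      - k * ((x * z - y) + (y * z - x) + (1 - z ^ 2)) * e3
      - (1 + 2 * x * y * z - x ^ 2 - y ^ 2 - z ^ 2) * hn
  rw [i1, i2, i3] at key
  have e : 1 - cs R ^ 2 = σ * sn R ^ 2 := by linarith
  rw [e] at key
  generalize gram cs (d B C) (d C A) (d A B) = G at *
  linear_combination σ * key + (16 * cs R ^ 2 * (sn (d B C / 2) * sn (d C A / 2) * sn (d A B / 2)) ^ 2 * (σ * σ + 1) - sn R ^ 2 * G) * hσ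

theorem tan_ratio (h : IsQuadricModel σ cs sn D b φ d) {A B C O I : X} {R r : ℝ}
    (hi : Indep (φ A) (φ B) (φ C))
    (hspan : ∀ W : V, ∃ p q s : ℝ, W = p • φ A + q • φ B + s • φ C)
    (hR : IsCircumscribedCircle d A B C O R) (hR0 : 0 < cs R)
    (hr : IsInscribedCircle d A B C I r) :
    (sn R / cs R) / (sn r / cs r) =
      2 * (sn (d B C / 2) * sn (d C A / 2) * sn (d A B / 2)) /
        (sn ((d C A + d A B - d B C) / 2) * sn ((d B C + d A B - d C A) / 2) *
          sn ((d B C + d C A - d A B) / 2)) := by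
  have q1 := h.dist_half_pos hi
  have q2 := h.dist_half_pos hi.rotate
  have q3 := h.dist_half_pos hi.rotate.rotate
  rw [add_comm (d A B) (d B C)] at q2
  set u := (d C A + d A B - d B C) / 2 with hu
  set v := (d B C + d A B - d C A) / 2 with hv
  set w := (d B C + d C A - d A B) / 2 with hw
  have ha : d B C = v + w := by rw [hv, hw]; ring
  have hb : d C A = u + w := by rw [hu, hw]; ring
  have hc : d A B = u + v := by rw [hu, hv]; ring
  have hpos : 0 < sn u * sn v * sn w := by positivity
  have f1 := h.sn_inradius_sq hi hr ha hb hc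
  have f2 := h.sn_circumradius_sq hspan hR
  have hG := h.gram_pos hi
  have hG' : gram cs (d B C) (d C A) (d A B) = 4 * sn (u + v + w) * (sn u * sn v * sn w) := by
    rw [gram, ha, hb, hc, ← h.gram_eq u v w]
  have hk := h.cs_inradius_pos hi hr
  have hr0 : 0 ≤ sn r := by
    obtain ⟨Z, -, hZ⟩ := hr.2.1.1
    exact h.sn_nonneg _ (hZ ▸ h.dist_mem _ _)
  have hRn : 0 ≤ sn R := h.sn_nonneg _ (hR.1 ▸ h.dist_mem _ _)
  have hhalf : ∀ P Q, 0 ≤ sn (d P Q / 2) := fun P Q =>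
    h.sn_nonneg _ (h.mem_of_le _ _ (h.dist_mem P Q)
      (by linarith [h.nonneg _ (h.dist_mem P Q)]) (by linarith [h.nonneg _ (h.dist_mem P Q)]))
  have hE : 0 ≤ sn (d B C / 2) * sn (d C A / 2) * sn (d A B / 2) :=
    mul_nonneg (mul_nonneg (hhalf _ _) (hhalf _ _)) (hhalf _ _)
  rw [hG'] at hG f2
  set E := sn (d B C / 2) * sn (d C A / 2) * sn (d A B / 2)
  set F := sn u * sn v * sn w
  -- The semiperimeter is not known to lie in `D`, so the sign is read off from the positive Gram
  -- determinant.
  have hs0 : 0 < sn (u + v + w) := by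
    have := pos_of_mul_pos_left hG hpos.le
    linarith
  have hrpos : 0 < sn r := by
    refine hr0.lt_of_ne fun e => ?_
    rw [← e] at f1
    have : 0 < cs r ^ 2 * F := by positivity
    linarith
  rw [← sq_eq_sq₀ (by positivity) (by positivity)]
  simp only [div_pow, mul_pow]
  rw [div_div_div_eq, div_eq_div_iff (by positivity) (by positivity)]
  refine mul_right_cancel₀ (mul_pos (by norm_num : (0:ℝ) < 4) hs0).ne' ?_
  linear_combination cs r ^ 2 * F * f2 - 16 * cs R ^ 2 * E ^ 2 * f1
end IsQuadricModel

/-! ### The chain of inequalities in a quadric model -/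

namespace IsQuadricModel

variable {X V : Type} [AddCommGroup V] [Module ℝ V] {σ : ℝ} {cs sn : ℝ → ℝ}
  {D : Set ℝ} {b : V →ₗ[ℝ] V →ₗ[ℝ] ℝ} {φ : X → V} {d : X → X → ℝ}

theorem indep_iff_linearIndependent {A B C : V} :
    Indep A B C ↔ LinearIndependent ℝ ![A, B, C] := by
  rw [Fintype.linearIndependent_iff]
  refine ⟨fun h g hg => ?_, fun h α β γ e => ?_⟩
  · rw [Fin.sum_univ_three] at hg
    obtain ⟨h0, h1, h2⟩ := h _ _ _ hg
    intro i
    fin_cases i <;> assumption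
  · have := h ![α, β, γ] (by rw [Fin.sum_univ_three]; exact e)
    exact ⟨this 0, this 1, this 2⟩

theorem Indep.exists_eq_comb {A B C : V} (h : Indep A B C) (hV : Module.finrank ℝ V = 3) (W : V) :
    ∃ p q s : ℝ, W = p • A + q • B + s • C := by
  have h1 := (indep_iff_linearIndependent.1 h).span_eq_top_of_card_eq_finrank (by simp [hV])
  have h2 : W ∈ Submodule.span ℝ (Set.range ![A, B, C]) := h1 ▸ Submodule.mem_top
  obtain ⟨g, hg⟩ := (Submodule.mem_span_range_iff_exists_fun ℝ).1 h2
  rw [Fin.sum_univ_three] at hg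
  exact ⟨_, _, _, hg.symm⟩

/-- Pairing a linear relation with the three vertices gives a homogeneous system with the Gram
matrix; the adjugate solves it. -/
theorem indep_of_gram_ne_zero (h : IsQuadricModel σ cs sn D b φ d) {A B C : X}
    (hG : gram cs (d B C) (d C A) (d A B) ≠ 0) : Indep (φ A) (φ B) (φ C) := by
  intro α β γ e
  have e1 := congrArg (b (φ A)) e
  have e2 := congrArg (b (φ B)) e
  have e3 := congrArg (b (φ C)) e
  simp only [map_add, map_smul, smul_eq_mul, h.form_self, map_zero, h.form_symm (φ B) (φ A),
    h.form_symm (φ C) (φ B), h.form_symm (φ A) (φ C), h.form_eq A B, h.form_eq B C,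
    h.form_eq C A] at e1 e2 e3
  rw [gram] at hG
  generalize cs (d B C) = x at *
  generalize cs (d C A) = y at *
  generalize cs (d A B) = z at *
  refine ⟨?_, ?_, ?_⟩ <;> refine (mul_eq_zero.1 ?_).resolve_left hG
  · linear_combination (1 - x ^ 2) * e1 + (x * y - z) * e2 + (x * z - y) * e3
  · linear_combination (x * y - z) * e1 + (1 - y ^ 2) * e2 + (y * z - x) * e3
  · linear_combination (x * z - y) * e1 + (y * z - x) * e2 + (1 - z ^ 2) * e3

/-- The chain of inequalities in a quadric model. -/
theorem ratio_ge_middleTerm (h : IsQuadricModel σ cs sn D b φ d) {m : ℝ}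
    (hs : SpreadDecreasing (fun x => sn (x / 2)) m) (hV : Module.finrank ℝ V = 3)
    {A B C : X} (hi : Indep (φ A) (φ B) (φ C))
    (ha : 2 * d B C < m) (hb : 2 * d C A < m) (hc : 2 * d A B < m) :
    (∀ (O I : X) (R r : ℝ), IsCircumscribedCircle d A B C O R → 0 < cs R →
      IsInscribedCircle d A B C I r →
        (sn R / cs R) / (sn r / cs r) ≥
          middleTerm (fun x => sn (x / 2)) (d B C) (d C A) (d A B) ∧
        ((sn R / cs R) / (sn r / cs r) =
          middleTerm (fun x => sn (x / 2)) (d B C) (d C A) (d A B) ↔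
            d B C = d C A ∧ d C A = d A B)) ∧
    middleTerm (fun x => sn (x / 2)) (d B C) (d C A) (d A B) ≥ 2 ∧
    (middleTerm (fun x => sn (x / 2)) (d B C) (d C A) (d A B) = 2 ↔
      d B C = d C A ∧ d C A = d A B) := by
  have l1 := h.dist_lt hi
  have l2 := h.dist_lt hi.rotate
  have l3 := h.dist_lt hi.rotate.rotate
  refine ⟨fun O I R r hR hR0 hr => ?_, hs.two_le_middleTerm (by linarith) (by linarith)
    (by linarith) (by linarith) (by linarith) (by linarith)⟩
  rw [h.tan_ratio hi (hi.exists_eq_comb hV) hR hR0 hr]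
  exact hs.middleTerm_le l1 (by linarith) l3 ha hb hc

end IsQuadricModel

/-! ### The sphere -/

theorem isTrigPair_cos_sin : IsTrigPair 1 Real.cos Real.sin (Set.Icc 0 Real.pi) where
  sign_sq := by norm_num
  sq_add t := by rw [one_mul, Real.cos_sq_add_sin_sq]
  cs_add x y := by rw [Real.cos_add, one_mul]
  sn_add := Real.sin_add
  cs_zero := Real.cos_zero
  sn_zero := Real.sin_zero
  sn_neg := Real.sin_neg
  hasDerivAt := Real.hasDerivAt_sin
  zero_mem := ⟨le_rfl, Real.pi_pos.le⟩
  nonneg _ hx := hx.1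
  mem_of_le _ _ hy h0 hxy := ⟨h0, hxy.trans hy.2⟩
  sn_nonneg _ hx := Real.sin_nonneg_of_mem_Icc hx
  sn_pos _ _ hy h0 hxy := Real.sin_pos_of_pos_of_lt_pi h0 (hxy.trans_le hy.2)
  anti := by simpa only [one_mul] using Real.strictAntiOn_cos
  sign_or_pos := Or.inl rfl

theorem isTrigPair_cosh_sinh : IsTrigPair (-1) Real.cosh Real.sinh (Set.Ici 0) where
  sign_sq := by norm_num
  sq_add t := by rw [neg_one_mul, ← sub_eq_add_neg, Real.cosh_sq_sub_sinh_sq]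
  cs_add x y := by rw [Real.cosh_add]; ring
  sn_add := Real.sinh_add
  cs_zero := Real.cosh_zero
  sn_zero := Real.sinh_zero
  sn_neg := Real.sinh_neg
  hasDerivAt := Real.hasDerivAt_sinh
  zero_mem := Set.self_mem_Ici
  nonneg _ hx := hx
  mem_of_le _ _ _ h0 _ := h0
  sn_nonneg _ hx := Real.sinh_nonneg_iff.2 hx
  sn_pos _ _ _ h0 _ := Real.sinh_pos_iff.2 h0
  anti x hx y hy hxy := by
    have : Real.cosh x < Real.cosh y := by
      rwa [Real.cosh_lt_cosh, abs_of_nonneg hx, abs_of_nonneg hy]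
    linarith
  sign_or_pos := Or.inr Real.cosh_pos

theorem isQuadricModel_sphere : IsQuadricModel 1 Real.cos Real.sin (Set.Icc 0 Real.pi)
    (innerₗ (EuclideanSpace ℝ (Fin 3))) (fun P : UnitSphere => (P : EuclideanSpace ℝ (Fin 3)))
    sphDist where
  toIsTrigPair := isTrigPair_cos_sin
  form_symm v w := real_inner_comm w v
  dist_mem P Q := ⟨InnerProductGeometry.angle_nonneg _ _, InnerProductGeometry.angle_le_pi _ _⟩
  form_eq P Q := by
    rw [sphDist, InnerProductGeometry.cos_angle]
    simp
  dist_self P := InnerProductGeometry.angle_self (ne_zero_of_mem_unit_sphere P)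
  dist_triangle P Q Z := InnerProductGeometry.angle_le_angle_add_angle _ _ _
  tangent_pos P v _ hv := by
    rw [one_mul]
    exact real_inner_self_pos.2 hv
  exists_point P v t _ h1 _ := by
    refine ⟨⟨v, ?_⟩, rfl⟩
    rw [mem_sphere_zero_iff_norm]
    have : ‖v‖ ^ 2 = 1 := by rw [← real_inner_self_eq_norm_sq]; exact h1
    exact (pow_eq_one_iff_of_nonneg (norm_nonneg v) two_ne_zero).1 this

theorem spherical_part (A B C : UnitSphere) (a b c : ℝ) (hT : IsSphTriangle A B C)
    (ha : a = sphDist B C) (hb : b = sphDist C A) (hc : c = sphDist A B) :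
    (∀ (O I : UnitSphere) (R r : ℝ),
      IsCircumscribedCircle sphDist A B C O R → R < Real.pi / 2 →
      IsInscribedCircle sphDist A B C I r →
        Real.tan R / Real.tan r ≥ middleTerm sSph a b c ∧
        (Real.tan R / Real.tan r = middleTerm sSph a b c ↔ a = b ∧ b = c)) ∧
    middleTerm sSph a b c ≥ 2 ∧
    (middleTerm sSph a b c = 2 ↔ a = b ∧ b = c) := by
  subst ha hb hc
  have hi := IsQuadricModel.indep_iff_linearIndependent.2 hT
  have hM := isQuadricModel_sphere
  -- Independence excludes antipodal vertices, so doubled sides stay below `2 * π`, where `sSph` is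
  -- positive.
  have hlt : ∀ {P Q : UnitSphere}, 0 < Real.sin (sphDist P Q) →
      2 * sphDist P Q < 2 * Real.pi := fun {P Q} hpos => by
    have : sphDist P Q < Real.pi := (hM.dist_mem P Q).2.lt_of_ne fun e => by
      rw [e, Real.sin_pi] at hpos
      exact lt_irrefl _ hpos
    linarith
  obtain ⟨h1, h2⟩ := hM.ratio_ge_middleTerm (m := 2 * Real.pi) spreadDecreasing_sSph (by simp) hi
    (hlt (hM.sn_dist_pos hi)) (hlt (hM.sn_dist_pos hi.rotate)) (hlt (hM.sn_dist_pos hi.rotate.rotate))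
  refine ⟨fun O I R r hR hR2 hr => ?_, h2⟩
  have hR0 : 0 ≤ R := hR.1 ▸ (hM.dist_mem O A).1
  rw [Real.tan_eq_sin_div_cos, Real.tan_eq_sin_div_cos]
  exact h1 O I R r hR (Real.cos_pos_of_mem_Ioo ⟨by linarith [Real.pi_pos], hR2⟩) hr

/-! ### The hyperbolic plane as a hyperboloid -/

/-- The Lorentz form on `ℝ³`. -/
def lorentzForm : (Fin 3 → ℝ) →ₗ[ℝ] (Fin 3 → ℝ) →ₗ[ℝ] ℝ :=
  LinearMap.mk₂ ℝ (fun v w => v 0 * w 0 - v 1 * w 1 - v 2 * w 2)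
    (fun _ _ _ => by simp only [Pi.add_apply]; ring)
    (fun _ _ _ => by simp only [Pi.smul_apply, smul_eq_mul]; ring)
    (fun _ _ _ => by simp only [Pi.add_apply]; ring)
    (fun _ _ _ => by simp only [Pi.smul_apply, smul_eq_mul]; ring)

theorem lorentzForm_apply (v w : Fin 3 → ℝ) :
    lorentzForm v w = v 0 * w 0 - v 1 * w 1 - v 2 * w 2 := rfl

/-- The point of the hyperboloid corresponding to a point of the upper half plane. -/
def toHyperboloid (z : UpperHalfPlane) : Fin 3 → ℝ :=
  ![(1 + z.re ^ 2 + z.im ^ 2) / (2 * z.im), z.re / z.im, (z.re ^ 2 + z.im ^ 2 - 1) / (2 * z.im)]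

theorem lorentzForm_toHyperboloid (z w : UpperHalfPlane) :
    lorentzForm (toHyperboloid z) (toHyperboloid w) = Real.cosh (dist z w) := by
  rw [UpperHalfPlane.cosh_dist', lorentzForm_apply]
  have h1 := z.im_pos.ne'
  have h2 := w.im_pos.ne'
  simp only [toHyperboloid, Matrix.cons_val_zero, Matrix.cons_val_one, Matrix.cons_val]
  field_simp
  ring

theorem sq_add_le_of_hyperboloid {t u w v1 v2 : ℝ} (h : t * t - u * u - w * w = 1) :
    (v1 * u + v2 * w) ^ 2 ≤ (v1 ^ 2 + v2 ^ 2) * (t ^ 2 - 1) := by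
  nlinarith [sq_nonneg (v1 * w - v2 * u)]

theorem toHyperboloid_zero_pos (z : UpperHalfPlane) : 0 < toHyperboloid z 0 := by
  have := z.im_pos
  simp only [toHyperboloid, Matrix.cons_val_zero]
  positivity

theorem exists_toHyperboloid_eq {v : Fin 3 → ℝ} (h1 : lorentzForm v v = 1) (h0 : 0 < v 0) :
    ∃ z, toHyperboloid z = v := by
  rw [lorentzForm_apply] at h1
  have h2 : 0 < v 0 - v 2 := by nlinarith [sq_nonneg (v 1)]
  -- In `toHyperboloid z` the difference of coordinates `0` and `2` is `1 / z.im`, and coordinate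
  -- `1` is `z.re / z.im`.
  refine ⟨⟨⟨v 1 / (v 0 - v 2), 1 / (v 0 - v 2)⟩, by positivity⟩, ?_⟩
  ext i
  fin_cases i
  · simp [toHyperboloid]
    field_simp
    linear_combination -h1
  · simp [toHyperboloid]
    field_simp
  · simp [toHyperboloid]
    field_simp
    linear_combination -h1

theorem isQuadricModel_hyperboloid : IsQuadricModel (-1) Real.cosh Real.sinh (Set.Ici 0)
    lorentzForm toHyperboloid (dist : UpperHalfPlane → UpperHalfPlane → ℝ) where
  toIsTrigPair := isTrigPair_cosh_sinh
  form_symm v w := by simp only [lorentzForm_apply]; ring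
  dist_mem P Q := dist_nonneg
  form_eq := lorentzForm_toHyperboloid
  dist_self := dist_self
  dist_triangle := dist_triangle
  tangent_pos P v h0 hv := by
    have h1 := lorentzForm_toHyperboloid P P
    rw [dist_self, Real.cosh_zero, lorentzForm_apply] at h1
    have ht := toHyperboloid_zero_pos P
    rw [lorentzForm_apply] at h0 ⊢
    have h2 := sq_add_le_of_hyperboloid (v1 := v 1) (v2 := v 2) h1
    set t := toHyperboloid P 0
    set u := toHyperboloid P 1
    set w := toHyperboloid P 2
    have h3 : v 0 * t = v 1 * u + v 2 * w := by linarith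
    rw [← h3] at h2
    have hN : 0 < v 1 ^ 2 + v 2 ^ 2 := by
      refine lt_of_le_of_ne (by positivity) fun e => hv ?_
      have e1 : v 1 = 0 := by nlinarith [sq_nonneg (v 1), sq_nonneg (v 2)]
      have e2 : v 2 = 0 := by nlinarith [sq_nonneg (v 1), sq_nonneg (v 2)]
      rw [e1, e2] at h3
      have e0 : v 0 = 0 := (mul_eq_zero.1 (by linarith : v 0 * t = 0)).resolve_right ht.ne'
      ext i
      fin_cases i <;> assumption
    -- By Cauchy–Schwarz `(v 0 * t) ^ 2 ≤ N * (t ^ 2 - 1)` with `N = v 1 ^ 2 + v 2 ^ 2 > 0`, so the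
    -- expression is at least `N`.
    have : 0 < t ^ 2 * (-1 * (v 0 * v 0 - v 1 * v 1 - v 2 * v 2)) := by nlinarith
    exact pos_of_mul_pos_right this (by positivity)
  exists_point P v t _ h1 h0 := by
    refine exists_toHyperboloid_eq h1 ?_
    have hp := lorentzForm_toHyperboloid P P
    rw [dist_self, Real.cosh_zero, lorentzForm_apply] at hp
    have ht := toHyperboloid_zero_pos P
    have h2 := sq_add_le_of_hyperboloid (v1 := v 1) (v2 := v 2) hp
    have hc := Real.cosh_pos t
    rw [← h0] at hc
    rw [lorentzForm_apply] at h1 hc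
    set t := toHyperboloid P 0
    set u := toHyperboloid P 1
    set w := toHyperboloid P 2
    -- A vector on the other sheet would pair negatively with `φ P`, against `hc`.
    by_contra hneg
    have h3 : v 0 * t ≤ 0 := mul_nonpos_of_nonpos_of_nonneg (not_lt.1 hneg) ht.le
    have h4 : (v 0 * t) ^ 2 ≤ (v 1 * u + v 2 * w) ^ 2 := by nlinarith
    nlinarith [sq_nonneg (v 1), sq_nonneg (v 2), sq_pos_of_pos ht]

theorem hyperbolic_part (A B C : UpperHalfPlane) (a b c : ℝ) (hT : IsHypTriangle A B C)
    (ha : a = dist B C) (hb : b = dist C A) (hc : c = dist A B) :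
    (∀ (O I : UpperHalfPlane) (R r : ℝ),
      IsCircumscribedCircle dist A B C O R → IsInscribedCircle dist A B C I r →
        Real.tanh R / Real.tanh r ≥ middleTerm sHyp a b c ∧
        (Real.tanh R / Real.tanh r = middleTerm sHyp a b c ↔ a = b ∧ b = c)) ∧
    middleTerm sHyp a b c ≥ 2 ∧
    (middleTerm sHyp a b c = 2 ↔ a = b ∧ b = c) := by
  subst ha hb hc
  have hM := isQuadricModel_hyperboloid
  have hlt : ∀ {P Q Z : UpperHalfPlane}, P ∉ geodSegment dist Q Z →
      0 < (dist P Q + dist Z P - dist Q Z) / 2 := fun {P Q Z} h => by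
    have h1 := dist_triangle Q P Z
    rw [dist_comm Q P, dist_comm P Z] at h1
    rcases h1.lt_or_eq with h2 | h2
    · linarith
    · refine absurd ?_ h
      simp only [geodSegment, Set.mem_ofPred_eq]
      rw [h2, dist_comm Q P, dist_comm P Z]
  have p1 := hlt hT.1
  have p2 := hlt hT.2.1
  have p3 := hlt hT.2.2
  -- Strict triangle inequalities make all factors of the Heron product positive, and a nonzero Gram
  -- determinant gives linear independence.
  have hG := isTrigPair_cosh_sinh.gram_eq ((dist A B + dist C A - dist B C) / 2)
    ((dist B C + dist A B - dist C A) / 2) ((dist C A + dist B C - dist A B) / 2)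
  have hi : IsQuadricModel.Indep (toHyperboloid A) (toHyperboloid B) (toHyperboloid C) := by
    refine hM.indep_of_gram_ne_zero (ne_of_gt ?_)
    have e1 : (dist B C + dist A B - dist C A) / 2 + (dist C A + dist B C - dist A B) / 2 =
      dist B C := by ring
    have e2 : (dist A B + dist C A - dist B C) / 2 + (dist C A + dist B C - dist A B) / 2 =
      dist C A := by ring
    have e3 : (dist A B + dist C A - dist B C) / 2 + (dist B C + dist A B - dist C A) / 2 =
      dist A B := by ring
    rw [e1, e2] at hG
    have hpos : 0 < 4 * Real.sinh ((dist A B + dist C A - dist B C) / 2 +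
        (dist B C + dist A B - dist C A) / 2 + (dist C A + dist B C - dist A B) / 2) *
        (Real.sinh ((dist A B + dist C A - dist B C) / 2) *
          Real.sinh ((dist B C + dist A B - dist C A) / 2) *
          Real.sinh ((dist C A + dist B C - dist A B) / 2)) := by
      have q1 := Real.sinh_pos_iff.2 p1
      have q2 := Real.sinh_pos_iff.2 p2
      have q3 := Real.sinh_pos_iff.2 p3
      have q0 := Real.sinh_pos_iff.2 (add_pos (add_pos p1 p2) p3)
      exact mul_pos (mul_pos (by norm_num) q0) (mul_pos (mul_pos q1 q2) q3)
    rw [← hG, e3] at hpos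
    exact hpos
  -- Since `sinh` imposes no upper bound, any `m` exceeding the doubled sides serves.
  obtain ⟨h1, h2⟩ := hM.ratio_ge_middleTerm (m := 2 * (dist B C + dist C A + dist A B))
    (spreadDecreasing_sHyp _) (by simp) hi (by linarith) (by linarith) (by linarith)
  refine ⟨fun O I R r hR hr => ?_, h2⟩
  rw [Real.tanh_eq_sinh_div_cosh, Real.tanh_eq_sinh_div_cosh]
  exact h1 O I R r hR (Real.cosh_pos R) hr

/-! ### The Euclidean ratio of radii -/

namespace Affine.Triangle

variable {V P : Type*} [NormedAddCommGroup V] [InnerProductSpace ℝ V] [MetricSpace P]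
  [NormedAddTorsor V P]

/-- The polynomial in the squared side lengths that equals `16` times the squared area. -/
def heron (a b c : ℝ) : ℝ := 4 * b ^ 2 * c ^ 2 - (b ^ 2 + c ^ 2 - a ^ 2) ^ 2

theorem heron_rotate (a b c : ℝ) : heron b c a = heron a b c := by
  simp only [heron]; ring

theorem height_sq_mul (T : Affine.Triangle ℝ P) {i j k : Fin 3} (hij : i ≠ j) (hik : i ≠ k)
    (hjk : j ≠ k) :
    4 * T.height i ^ 2 * dist (T.points j) (T.points k) ^ 2 =
      heron (dist (T.points j) (T.points k)) (dist (T.points k) (T.points i))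
        (dist (T.points i) (T.points j)) := by
  have h1 := T.altitudeFoot_mem_affineSpan_image_compl i
  have hc : ({i}ᶜ : Set (Fin 3)) = {j, k} := by
    ext l
    simp only [Set.mem_compl_iff, Set.mem_singleton_iff, Set.mem_insert_iff]
    omega
  rw [hc, Set.image_pair, mem_affineSpan_pair_iff_exists_lineMap_eq] at h1
  obtain ⟨t, ht⟩ := h1
  have o1 : inner ℝ (T.points j -ᵥ T.altitudeFoot i) (T.points i -ᵥ T.altitudeFoot i) = 0 :=
    T.inner_vsub_altitudeFoot_vsub_altitudeFoot_eq_zero hij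
  have o2 : inner ℝ (T.points k -ᵥ T.altitudeFoot i) (T.points i -ᵥ T.altitudeFoot i) = 0 :=
    T.inner_vsub_altitudeFoot_vsub_altitudeFoot_eq_zero hik
  set A := T.points i
  set B := T.points j
  set C := T.points k
  have e1 : B -ᵥ T.altitudeFoot i = -(t • (C -ᵥ B)) := by
    rw [← ht, AffineMap.lineMap_apply, vsub_vadd_eq_vsub_sub, vsub_self, zero_sub]
  have e2 : A -ᵥ T.altitudeFoot i = (A -ᵥ B) - t • (C -ᵥ B) := by
    rw [← ht, AffineMap.lineMap_apply, vsub_vadd_eq_vsub_sub]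
  have e3 : C -ᵥ T.altitudeFoot i = (C -ᵥ B) - t • (C -ᵥ B) := by
    rw [← ht, AffineMap.lineMap_apply, vsub_vadd_eq_vsub_sub]
  have d1 : dist A C = ‖(A -ᵥ B) - (C -ᵥ B)‖ := by
    rw [vsub_sub_vsub_cancel_right, dist_eq_norm_vsub V]
  have d2 : dist A B = ‖A -ᵥ B‖ := dist_eq_norm_vsub V _ _
  have d3 : dist C B = ‖C -ᵥ B‖ := dist_eq_norm_vsub V _ _
  have d4 : T.height i = ‖(A -ᵥ B) - t • (C -ᵥ B)‖ := by
    rw [← e2, Simplex.height, dist_eq_norm_vsub V]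
  rw [dist_comm B C, dist_comm C A, heron, d1, d2, d3, d4]
  rw [e1, e2] at o1
  rw [e3, e2] at o2
  have n1 := norm_sub_sq_real (A -ᵥ B) (t • (C -ᵥ B))
  have n2 := norm_sub_sq_real (A -ᵥ B) (C -ᵥ B)
  simp only [inner_sub_left, inner_sub_right, inner_neg_left, inner_smul_left, inner_smul_right,
    real_inner_self_eq_norm_sq, norm_smul, mul_pow, Real.norm_eq_abs, sq_abs, conj_trivial,
    real_inner_comm (A -ᵥ B) (C -ᵥ B)] at o1 o2 n1
  rw [n1, n2]
  generalize inner ℝ (A -ᵥ B) (C -ᵥ B) = p at *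
  have o3 : p = t * ‖C -ᵥ B‖ ^ 2 := by linarith
  rw [o3]
  ring

theorem circumradius_div_inradius (T : Affine.Triangle ℝ P) {a b c : ℝ}
    (ha : a = dist (T.points 1) (T.points 2)) (hb : b = dist (T.points 2) (T.points 0))
    (hc : c = dist (T.points 0) (T.points 1)) :
    0 < (a + b + c) * ((b + c - a) * (a + c - b) * (a + b - c)) ∧
    T.circumradius / T.inradius =
      2 * (a * b * c) / ((b + c - a) * (a + c - b) * (a + b - c)) := by
  have g1 := T.height_sq_mul (i := 0) (j := 1) (k := 2) (by decide) (by decide) (by decide)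
  have g2 := T.height_sq_mul (i := 1) (j := 2) (k := 0) (by decide) (by decide) (by decide)
  have g3 := T.height_sq_mul (i := 2) (j := 0) (k := 1) (by decide) (by decide) (by decide)
  have hne : ∀ {i j : Fin 3}, i ≠ j → 0 < dist (T.points i) (T.points j) := fun hij =>
    dist_pos.2 (T.independent.injective.ne hij)
  have pa : 0 < a := ha ▸ hne (by decide)
  have pb : 0 < b := hb ▸ hne (by decide)
  have pc : 0 < c := hc ▸ hne (by decide)
  have hsin := T.dist_div_sin_angle_eq_two_mul_circumradius (i₁ := 1) (i₂ := 0) (i₃ := 2)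
    (by decide) (by decide) (by decide)
  have hcos := EuclideanGeometry.law_cos (T.points 1) (T.points 0) (T.points 2)
  have hang := Real.sin_sq_add_cos_sq
    (EuclideanGeometry.angle (T.points 1) (T.points 0) (T.points 2))
  rw [dist_comm (T.points 1) (T.points 0)] at hcos
  rw [← ha, ← hb, ← hc] at g1 g2 g3 hcos
  rw [← ha] at hsin
  rw [heron_rotate] at g2
  rw [heron_rotate, heron_rotate] at g3
  have hr : T.inradius = |((T.height 0)⁻¹ + (T.height 1)⁻¹ + (T.height 2)⁻¹)⁻¹| := by
    rw [T.inradius_eq_abs_inv_sum]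
    simp only [Simplex.excenterWeightsUnnorm_empty_apply]
    exact congrArg (fun t => |t⁻¹|) (Fin.sum_univ_three fun i => (T.height i)⁻¹)
  have ph : ∀ i, 0 < T.height i := T.height_pos
  have hH : 0 < heron a b c := by
    rw [← g1]
    have := ph 0
    positivity
  have hfac : heron a b c = (a + b + c) * ((b + c - a) * (a + c - b) * (a + b - c)) := by
    rw [heron]; ring
  have hq : 0 < (b + c - a) * (a + c - b) * (a + b - c) := by
    rw [hfac] at hH
    exact pos_of_mul_pos_right hH (by positivity)
  refine ⟨hfac ▸ hH, ?_⟩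
  have hroot : ∀ {h s : ℝ}, 0 < h → 0 < s → 4 * h ^ 2 * s ^ 2 = heron a b c →
      h⁻¹ = 2 * s / √(heron a b c) := fun {h s} hh hs e => by
    have : √(heron a b c) = 2 * h * s := by
      rw [← e, show 4 * h ^ 2 * s ^ 2 = (2 * h * s) ^ 2 by ring]
      exact Real.sqrt_sq (by positivity)
    rw [this]
    field_simp
  rw [hroot (ph 0) pa g1, hroot (ph 1) pb g2, hroot (ph 2) pc g3] at hr
  have hk := Real.sq_sqrt hH.le
  have pk := Real.sqrt_pos.2 hH
  -- Here `k` is four times the area, so `r = k / (2 * (a + b + c))` comes from the heights and `R =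
  -- a * b * c / k` from the law of sines.
  set k := √(heron a b c)
  have hr' : T.inradius = k / (2 * (a + b + c)) := by
    rw [hr, abs_of_nonneg (by positivity)]
    field_simp
  set S := Real.sin (EuclideanGeometry.angle (T.points 1) (T.points 0) (T.points 2))
  have hS0 : 0 ≤ S := InnerProductGeometry.sin_angle_nonneg _ _
  have hS : 2 * b * c * S = k := by
    refine (sq_eq_sq₀ (by positivity) pk.le).1 ?_
    rw [hk, heron]
    generalize Real.cos (EuclideanGeometry.angle (T.points 1) (T.points 0) (T.points 2)) = x at *
    have : b ^ 2 + c ^ 2 - a ^ 2 = 2 * b * c * x := by linear_combination -hcos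
    rw [this]
    linear_combination 4 * b ^ 2 * c ^ 2 * hang
  have hS1 : S = k / (2 * b * c) := by
    rw [← hS]; field_simp
  have hR : T.circumradius = a * b * c / k := by
    rw [hS1] at hsin
    field_simp at hsin ⊢
    linarith
  rw [hR, hr', div_div_div_eq, div_eq_div_iff (by positivity) hq.ne']
  rw [hfac] at hk
  linear_combination (-2 * (a * b * c)) * hk

end Affine.Triangle

theorem euclidean_part (T : Affine.Triangle ℝ (EuclideanSpace ℝ (Fin 2))) (a b c : ℝ)
    (ha : a = dist (T.points 1) (T.points 2)) (hb : b = dist (T.points 2) (T.points 0))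
    (hc : c = dist (T.points 0) (T.points 1)) :
    T.circumradius / T.inradius ≥ middleTerm sEuc a b c ∧
    middleTerm sEuc a b c ≥ 2 ∧
    (T.circumradius / T.inradius = middleTerm sEuc a b c ↔ a = b ∧ b = c) ∧
    (middleTerm sEuc a b c = 2 ↔ a = b ∧ b = c) := by
  obtain ⟨h0, h1⟩ := Affine.Triangle.circumradius_div_inradius T ha hb hc
  have tri : ∀ P Q S : EuclideanSpace ℝ (Fin 2), dist P Q ≤ dist Q S + dist S P :=
    fun P Q S => by
      rw [dist_comm Q S, dist_comm S P, add_comm]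
      exact dist_triangle P S Q
  have t1 : a ≤ b + c := ha.trans_le ((tri _ _ _).trans_eq (by rw [hb, hc]))
  have t2 : b ≤ c + a := hb.trans_le ((tri _ _ _).trans_eq (by rw [hc, ha]))
  have t3 : c ≤ a + b := hc.trans_le ((tri _ _ _).trans_eq (by rw [ha, hb]))
  rw [add_comm] at t2
  have s1 : a < b + c := t1.lt_of_ne fun e => by simp [← e] at h0
  have s2 : b < a + c := t2.lt_of_ne fun e => by simp [← e] at h0
  have s3 : c < a + b := t3.lt_of_ne fun e => by simp [← e] at h0
  have hs := spreadDecreasing_sEuc (2 * (a + b + c))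
  obtain ⟨h2, h3⟩ := hs.middleTerm_le s1 s2 s3 (by linarith) (by linarith) (by linarith)
  obtain ⟨h4, h5⟩ := hs.two_le_middleTerm (a := a) (b := b) (c := c) (by linarith) (by linarith)
    (by linarith) (by linarith) (by linarith) (by linarith)
  have e : T.circumradius / T.inradius = 2 * (sEuc a * sEuc b * sEuc c) /
      (sEuc (b + c - a) * sEuc (a + c - b) * sEuc (a + b - c)) := by
    rw [h1]
    simp only [sEuc]
    have n1 : b + c - a ≠ 0 := by linarith
    have n2 : a + c - b ≠ 0 := by linarith
    have n3 : a + b - c ≠ 0 := by linarith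
    field_simp
  rw [e]
  exact ⟨h2, h4, h3, h5⟩

end

theorem mainTheorem1 :
    -- Euclidean geometry
    (∀ (T : Affine.Triangle ℝ (EuclideanSpace ℝ (Fin 2))) (a b c : ℝ),
      a = dist (T.points 1) (T.points 2) →
      b = dist (T.points 2) (T.points 0) →
      c = dist (T.points 0) (T.points 1) →
        T.circumradius / T.inradius ≥ middleTerm sEuc a b c ∧
        middleTerm sEuc a b c ≥ 2 ∧
        (T.circumradius / T.inradius = middleTerm sEuc a b c ↔ a = b ∧ b = c) ∧
        (middleTerm sEuc a b c = 2 ↔ a = b ∧ b = c)) ∧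
    -- hyperbolic geometry; `R` is the radius of the circumscribed circle, if there is one
    (∀ (A B C : UpperHalfPlane) (a b c : ℝ), IsHypTriangle A B C →
      a = dist B C → b = dist C A → c = dist A B →
        (∀ (O I : UpperHalfPlane) (R r : ℝ),
          IsCircumscribedCircle dist A B C O R → IsInscribedCircle dist A B C I r →
            Real.tanh R / Real.tanh r ≥ middleTerm sHyp a b c ∧
            (Real.tanh R / Real.tanh r = middleTerm sHyp a b c ↔ a = b ∧ b = c)) ∧
        middleTerm sHyp a b c ≥ 2 ∧
        (middleTerm sHyp a b c = 2 ↔ a = b ∧ b = c)) ∧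
    -- spherical geometry; `R < π / 2` selects one of the two antipodal centres of a circle
    (∀ (A B C : UnitSphere) (a b c : ℝ), IsSphTriangle A B C →
      a = sphDist B C → b = sphDist C A → c = sphDist A B →
        (∀ (O I : UnitSphere) (R r : ℝ),
          IsCircumscribedCircle sphDist A B C O R → R < Real.pi / 2 →
          IsInscribedCircle sphDist A B C I r →
            Real.tan R / Real.tan r ≥ middleTerm sSph a b c ∧
            (Real.tan R / Real.tan r = middleTerm sSph a b c ↔ a = b ∧ b = c)) ∧
        middleTerm sSph a b c ≥ 2 ∧
        (middleTerm sSph a b c = 2 ↔ a = b ∧ b = c)) :=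
  ⟨euclidean_part, hyperbolic_part, spherical_part⟩
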